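/- Let $\boldsymbol l=(l_k)_{k\ge1}$ be a sequence of odd integers $l_k\ge3$. In $\mathbb C$ put $q_0=0$, $q_j=e^{(2j-1)\pi i/4}$ $(1\le j\le4)$, let $K_0$ be the closed square with vertices $q_1,\dots,q_4$, and for odd $l\ge 3$ let $S_l=\{2nl^{-1}q_j:0\le n\le (l-1)/2,\ 1\le j\le4\}$. For $n\ge 0$ and $w\in W_n:=S_{l_1}\times\dots\times S_{l_n}$ let $F_w=F^{l_1}_{w_1}\circ\dots\circ F^{l_n}_{w_n}$ with $F^{l}_{a}(z)=a+l^{-1}z$ (the identity if $n=0$). The scale-irregular Vicsek set is $$K=\bigcap_{n\ge1}\bigcup_{w\in W_n}F_w(K_0)\subset\mathbb C .$$ Let $V_n=\bigcup_{w\in W_n}F_w(\{q_0,\dots,q_4\})\subset K$ and call $x,y\in V_n$ adjacent, $x\sim_n y$, if $|x-y|=\prod_{k=1}^n l_k^{-1}$; for adjacent $x,y\in V_n$ write $x\prec y$ if $x$ is nearer than $y$ to $0$ in the graph distance of $(V_n,\sim_n)$. Let the skeleton $\mathcal S\subset K$ be the union of the segments $[x,y]$ over all $n\ge0$ and all $x\sim_n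 y$, and let $\nu$ be the length measure (one-dimensional Hausdorff measure) on $\mathcal S$, extended to $K$ by $\nu(K\setminus\mathcal S)=0$. For $1<p<\infty$ and $u\in C(K)$ (real-valued) let $$\mathcal E_p(u)=\sup_{n\ge0}\ \frac12\Big(\prod_{k=1}^n l_k^{p-1}\Big)\sum_{x,y\in V_n,\ x\sim_n y}|u(x)-u(y)|^p,\qquad \mathcal F_p=\{u\in C(K):\mathcal E_p(u)<\infty\}.$$ Theorem. Let $1<p<\infty$. Each $u\in\mathcal F_p$ has a gradient $\partial u\in L^p(K,\nu)$, unique $\nu$-a.e., such that $u(y)-u(x)=\int_{[x,y]}\partial u\,d\nu$ for all $n\ge0$ and all adjacent $x\prec y$ in $V_n$. The measures $d\Gamma_p\langle u\rangle:=|\partial u|^p\,d\nu$, $u\in\mathcal F_p$, are finite Borel measures on $K$ with the following properties. 1. For $u\in\mathcal F_p$, $\Gamma_p\langle u\rangle(K)=\mathcal E_p(u)$, and $\Gamma_p\langle u\rangle=0$ if and only if $u$ is constant. 2. For $u_1,u_2\in\mathcal F_p$ one has $u_1+u_2\in\mathcal F_p$, and for every Borel measurable $g:K\to[0,\infty]$,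 $$\Big(\int_K g\,d\Gamma_p\langle u_1+u_2\rangle\Big)^{1/p}\le\Big(\int_K g\,d\Gamma_p\langle u_1\rangle\Big)^{1/p}+\Big(\int_K g\,d\Gamma_p\langle u_2\rangle\Big)^{1/p}.$$ 3. For $f\in C^1(\mathbb R)$ and $u\in\mathcal F_p$ one has $f\circ u\in\mathcal F_p$ and $d\Gamma_p\langle f\circ u\rangle=|f'(u)|^p\,d\Gamma_p\langle u\rangle$. 4. (Energy image density property) For $u\in\mathcal F_p$, the push-forward $u_*\Gamma_p\langle u\rangle$ on $\mathbb R$ is absolutely continuous with respect to Lebesgue measure $\mathscr L^1$. -/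

import Mathlib

open MeasureTheory
open scoped ENNReal

namespace Vicsek

/-- The points `q_0 = 0` and `q_j = exp((2j-1)πi/4)` for `1 ≤ j ≤ 4`, in the complex plane. -/
noncomputable def q (j : ℕ) : ℂ :=
  if j = 0 then 0 else Complex.exp ((2 * (j : ℂ) - 1) * (Real.pi : ℂ) * Complex.I / 4)

/-- The closed square `K_0` with vertices `q_1, q_2, q_3, q_4`. -/
noncomputable def K0 : Set ℂ :=
  convexHull ℝ {z | ∃ j : ℕ, 1 ≤ j ∧ j ≤ 4 ∧ z = q j}

/-- The alphabet `S_l = {2 n l⁻¹ q_j : 0 ≤ n ≤ (l-1)/2, 1 ≤ j ≤ 4}` (for odd `l`). -/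
noncomputable def S (l : ℕ) : Set ℂ :=
  {z | ∃ n j : ℕ, 2 * n + 1 ≤ l ∧ 1 ≤ j ∧ j ≤ 4 ∧ z = 2 * (n : ℂ) * (l : ℂ)⁻¹ * q j}

/-- The contraction `F_w^l(z) = w + l⁻¹ z`. -/
noncomputable def contr (l : ℕ) (w z : ℂ) : ℂ := w + (l : ℂ)⁻¹ * z

/-- Infinite sequences whose first `n` letters form a word of `W_n = S_{l_1} × ⋯ × S_{l_n}`.
The sequence `(l_k)_{k ≥ 1}` is indexed from `0`: the term `l k` is `l_{k+1}`.
Only the first `n` letters are ever used below. -/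
def words (l : ℕ → ℕ) (n : ℕ) : Set (ℕ → ℂ) := {w | ∀ k < n, w k ∈ S (l k)}

/-- The map `F_{w_1}^{l_1} ∘ ⋯ ∘ F_{w_n}^{l_n}` given by the first `n` letters of `w`. -/
noncomputable def wordMap (l : ℕ → ℕ) (w : ℕ → ℂ) : ℕ → ℂ → ℂ
  | 0 => id
  | n + 1 => wordMap l w n ∘ contr (l n) (w n)

/-- The scale-irregular Vicsek set `K = ⋂_{n ≥ 1} ⋃_{w ∈ W_n} F_w(K_0)`. -/
noncomputable def K (l : ℕ → ℕ) : Set ℂ :=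
  ⋂ (n : ℕ) (_ : 1 ≤ n), ⋃ w ∈ words l n, wordMap l w n '' K0

/-- The vertex set `V_n = ⋃_{w ∈ W_n} F_w({q_0, …, q_4})`; for `n = 0` it is `{q_0, …, q_4}`. -/
noncomputable def V (l : ℕ → ℕ) (n : ℕ) : Set ℂ :=
  ⋃ w ∈ words l n, wordMap l w n '' {z | ∃ j : ℕ, j ≤ 4 ∧ z = q j}

/-- The length `l_1⁻¹ ⋯ l_n⁻¹` of the edges of level `n`. -/
noncomputable def edgeLength (l : ℕ → ℕ) (n : ℕ) : ℝ := ∏ k ∈ Finset.range n, ((l k : ℝ))⁻¹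

/-- Adjacency in the graph `(V_n, E_n)`. -/
def Adjacent (l : ℕ → ℕ) (n : ℕ) (x y : ℂ) : Prop :=
  x ∈ V l n ∧ y ∈ V l n ∧ dist x y = edgeLength l n

/-- The graph `(V_n, E_n)` as a simple graph on `ℂ` (points outside `V_n` are isolated). -/
def graph (l : ℕ → ℕ) (n : ℕ) : SimpleGraph ℂ := SimpleGraph.fromRel (Adjacent l n)

/-- `x ≺ y`: the points `x, y` are adjacent in `V_n` and `x` is closer to `0` than `y` in the
geodesic distance of the cable system (which is `edgeLength l n` times the graph distance). -/
def Prec (l : ℕ → ℕ) (n : ℕ) (x y : ℂ) : Prop :=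
  Adjacent l n x y ∧ (graph l n).dist 0 x < (graph l n).dist 0 y

/-- The skeleton: the union over all levels `n` of the cable systems, i.e. of all the segments
`[x, y]` with `x, y` adjacent in `V_n`. -/
noncomputable def skeleton (l : ℕ → ℕ) : Set ℂ :=
  {z | ∃ (n : ℕ) (x y : ℂ), Adjacent l n x y ∧ z ∈ segment ℝ x y}

/-- The length measure `ν` on `K`: Lebesgue measure (one-dimensional Hausdorff measure)
on the skeleton, and zero off the skeleton. -/
noncomputable def ν (l : ℕ → ℕ) : Measure (K l) :=
  (Measure.hausdorffMeasure 1 : Measure (K l)).restrict {z | (z : ℂ) ∈ skeleton l}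

/-- The discrete `p`-energy
`½ (∏_{k=1}^n l_k^{p-1}) ∑_{(x,y) ∈ E_n} |u x - u y|^p`, as an element of `[0, ∞]`. -/
noncomputable def discreteEnergy (l : ℕ → ℕ) (p : ℝ) (n : ℕ) (u : C(K l, ℝ)) : ℝ≥0∞ :=
  2⁻¹ * (∏ k ∈ Finset.range n, (l k : ℝ≥0∞) ^ (p - 1)) *
    ∑' e : {e : K l × K l // Adjacent l n e.1 e.2}, ENNReal.ofReal (|u e.1.1 - u e.1.2| ^ p)

/-- The `p`-energy `𝓔_p(u) = sup_n 𝓔_{p,n}(u)`. -/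
noncomputable def energy (l : ℕ → ℕ) (p : ℝ) (u : C(K l, ℝ)) : ℝ≥0∞ :=
  ⨆ n : ℕ, discreteEnergy l p n u

/-- The domain `𝓕_p` of continuous functions of finite `p`-energy. -/
def domain (l : ℕ → ℕ) (p : ℝ) : Set C(K l, ℝ) := {u | energy l p u < ∞}

/-- `g` is the gradient `∂u`: it lies in `L^p(ν)`, and `u(y) - u(x) = ∫_{[x,y]} g dν` for all
adjacent `x ≺ y` of all levels. -/
def IsGradient (l : ℕ → ℕ) (p : ℝ) (u : C(K l, ℝ)) (g : K l → ℝ) : Prop :=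
  MemLp g (ENNReal.ofReal p) (ν l) ∧
    ∀ (n : ℕ) (x y : K l), Prec l n x y →
      u y - u x = ∫ z in {z : K l | (z : ℂ) ∈ segment ℝ (x : ℂ) (y : ℂ)}, g z ∂(ν l)

end Vicsek

/-! The skeleton is a countable union of edges and carries all of `ν`. On each edge `ν` is Lebesgue
measure in the arc length parameter (`restrict_edgeSet`), and a property holds `ν`-a.e. as soon as
it holds a.e. along every edge curve (`ae_of_edgeCurve`). So the theorem is one-dimensional calculus
along edges.

If `u` has finite energy, its discrete energies on the grids of an edge are bounded, and Hölder's
inequality with continuity makes `u` absolutely continuous there (`absolutelyContinuous_of_grid`).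
The slopes of the piecewise affine interpolations converge a.e. to the derivative (`tendsto_slope`);
their limit is a single measurable function on `K`, the gradient. Fatou's lemma bounds the integral
of `|∂u|^p` by the energy (`lintegral_le_energy`), and Jensen's inequality on each edge gives the
converse (`IsGradient.discreteEnergy_le`). Uniqueness holds because a function with vanishing
integrals over all grid intervals is zero a.e. (`ae_eq_zero_of_grid`). What is then left of the
first three properties is Minkowski's inequality, the chain rule along curves, and the connectedness
and density of the vertices.

For the image density property it suffices to treat a compact null set `A`. Take `C^1` functions `F
k` whose derivatives tend boundedly to the indicator of `A`. Since `A` is null, `F k` tends to `0`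
pointwise, and the limit of the chain rule says that `1_A(u) ∂u` is a gradient of the zero function.
By uniqueness it vanishes a.e.

The combinatorial work concerns `≺`, defined by graph distance: it must be inherited by the pieces
of an edge at finer levels (`Prec.grid`). The orientation `orient`, defined by recursion on the
level, has this property by construction. At most one arrow enters a vertex and none enters `0`, so
distance to `0` grows along arrows (`dist_eq_of_arrows`) and the arrows are exactly `≺`
(`prec_iff`). -/

namespace Vicsek

/-! ### Combinatorics of the orientation in lattice coordinates -/

/-- The four unit vectors of the lattice `ℤ × ℤ`. -/
def IsDir (e : ℤ × ℤ) : Prop := e = (1, 0) ∨ e = (0, 1) ∨ e = (-1, 0) ∨ e = (0, -1)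

/-- The centres of the cells of level `n`, in units of the edge length of level `n` and
in coordinates along the diagonals of the square. -/
inductive Center (l : ℕ → ℕ) : ℕ → ℤ × ℤ → Prop
  | zero : Center l 0 0
  | succ {n m : ℕ} {c e : ℤ × ℤ} : Center l n c → IsDir e → 2 * m + 1 ≤ l n →
      Center l (n + 1) ((l n : ℤ) • c + (2 * m : ℤ) • e)

/-- The even number `c` for which `x` lies in `[L (c - 1), L (c + 1))`. -/
def evenRound (L x : ℤ) : ℤ := 2 * ((x + L) / (2 * L))

/-- The orientation of the edge from the centre `c` of a cell of level `n` in the direction `f`: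
it is `1` if the edge leads away from `0` and `-1` if it leads towards `0`. -/
def orient (l : ℕ → ℕ) : ℕ → ℤ × ℤ → ℤ × ℤ → ℤ
  | 0, _, _ => 1
  | n + 1, c, f =>
    let b : ℤ × ℤ := (evenRound (l n) c.1, evenRound (l n) c.2)
    let d : ℤ × ℤ := c - (l n : ℤ) • b
    if d = 0 then orient l n b f
    else if 0 < d.1 * f.1 + d.2 * f.2 then orient l n b f
    else if d.1 * f.1 + d.2 * f.2 < 0 then - orient l n b (-f)
    else 1

/-- The oriented edges of level `n`, pointing away from `0`. -/
def Arrow (l : ℕ → ℕ) (n : ℕ) (a b : ℤ × ℤ) : Prop :=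
  ∃ c e, Center l n c ∧ IsDir e ∧
    ((orient l n c e = 1 ∧ a = c ∧ b = c + e) ∨ (orient l n c e = -1 ∧ a = c + e ∧ b = c))

theorem IsDir.neg {e : ℤ × ℤ} (h : IsDir e) : IsDir (-e) := by
  rcases h with rfl | rfl | rfl | rfl <;> simp [IsDir]

theorem Center.even {l : ℕ → ℕ} {n : ℕ} {c : ℤ × ℤ} (hc : Center l n c) : 2 ∣ c.1 ∧ 2 ∣ c.2 := by
  induction hc with
  | zero => simp
  | succ _ _ _ ih =>
    obtain ⟨h1, h2⟩ := ih
    refine ⟨?_, ?_⟩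
    · simpa using (h1.mul_left _).add (Dvd.intro _ (mul_assoc _ _ _).symm)
    · simpa using (h2.mul_left _).add (Dvd.intro _ (mul_assoc _ _ _).symm)

/-- A centre of level `n + 1` is `L` times its parent centre, which is even, plus a displacement
smaller than `L` in each coordinate. Rounding therefore recovers the parent. -/
theorem evenRound_eq {L c d : ℤ} (hc : 2 ∣ c) (h1 : -L ≤ d) (h2 : d < L) :
    evenRound L (L * c + d) = c := by
  obtain ⟨k, rfl⟩ := hc
  have : (L * (2 * k) + d + L) / (2 * L) = k := by
    rw [show L * (2 * k) + d + L = (d + L) + (2 * L) * k by ring,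
      Int.add_mul_ediv_left _ _ (by omega), Int.ediv_eq_zero_of_lt (by omega) (by omega), zero_add]
  rw [evenRound, this]

/-- The central subcell inherits the four edges of its parent. A subcell further out on the axis `e`
continues the orientation of that axis, with a change of sign for its edge pointing back to the
centre. The edges across the axis are side branches, which lead away from `0`. -/
theorem orient_succ {l : ℕ → ℕ} {n m : ℕ} {c e : ℤ × ℤ} (hc : Center l n c) (he : IsDir e)
    (hm : 2 * m + 1 ≤ l n) (f : ℤ × ℤ) :
    orient l (n + 1) ((l n : ℤ) • c + (2 * m : ℤ) • e) f =
      if m = 0 then orient l n c f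
      else if 0 < e.1 * f.1 + e.2 * f.2 then orient l n c f
      else if e.1 * f.1 + e.2 * f.2 < 0 then - orient l n c (-f)
      else 1 := by
  obtain ⟨h1, h2⟩ := hc.even
  have hb1 : evenRound (l n) ((l n : ℤ) * c.1 + (2 * m : ℤ) * e.1) = c.1 := by
    apply evenRound_eq h1 <;> rcases he with rfl | rfl | rfl | rfl <;> simp <;> omega
  have hb2 : evenRound (l n) ((l n : ℤ) * c.2 + (2 * m : ℤ) * e.2) = c.2 := by
    apply evenRound_eq h2 <;> rcases he with rfl | rfl | rfl | rfl <;> simp <;> omega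
  simp only [orient, Prod.fst_add, Prod.snd_add, Prod.smul_fst, Prod.smul_snd, smul_eq_mul,
    hb1, hb2, Prod.mk.eta, add_sub_cancel_left]
  have hd : (2 * (m : ℤ)) • e = 0 ↔ m = 0 := by
    rcases he with rfl | rfl | rfl | rfl <;> simp
  simp only [hd]
  rcases Nat.eq_zero_or_pos m with h0 | h0
  · simp [h0]
  have hm' : (0 : ℤ) < 2 * m := by omega
  simp only [show 2 * (m : ℤ) * e.1 * f.1 + 2 * (m : ℤ) * e.2 * f.2
    = 2 * (m : ℤ) * (e.1 * f.1 + e.2 * f.2) by ring, mul_pos_iff_of_pos_left hm', mul_neg_iff,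
    hm', not_lt.2 hm'.le, true_and, false_and, or_false]

theorem orient_eq {l : ℕ → ℕ} {n : ℕ} {c : ℤ × ℤ} (hc : Center l n c) :
    ∀ f, orient l n c f = 1 ∨ orient l n c f = -1 := by
  induction hc with
  | zero => simp [orient]
  | succ hc he hm ih =>
    intro f
    rw [orient_succ hc he hm]
    have h1 := ih f
    have h2 := ih (-f)
    split_ifs <;> omega

theorem orient_zero (l : ℕ → ℕ) (hl : ∀ k, Odd (l k) ∧ 3 ≤ l k) (n : ℕ) (f : ℤ × ℤ) :
    orient l n 0 f = 1 := by
  induction n with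
  | zero => rfl
  | succ n ih =>
    have h : evenRound (l n) 0 = 0 := by
      have := hl n
      simpa using evenRound_eq (L := l n) (c := 0) (d := 0) (by simp) (by omega) (by omega)
    have ih' : orient l n (0, 0) f = 1 := ih
    simp [orient, h, ih']

/-- At most one of the edges at the centre of a cell leads towards `0`. -/
theorem orient_neg_unique {l : ℕ → ℕ} {n : ℕ} {c : ℤ × ℤ} (hc : Center l n c) :
    ∀ {e e' : ℤ × ℤ}, IsDir e → IsDir e' → orient l n c e = -1 → orient l n c e' = -1 → e = e' := by
  induction hc with
  | zero => simp [orient]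
  | @succ n m c d hc hd hm ih =>
    intro f f' hf hf' h h'
    rw [orient_succ hc hd hm] at h h'
    by_cases hm0 : m = 0
    · simp only [hm0, if_true] at h h'
      exact ih hf hf' h h'
    simp only [hm0, if_false] at h h'
    -- Across the axis the value is `1`, and the two edges along the axis have opposite values.
    rcases hd with rfl | rfl | rfl | rfl <;> rcases hf with rfl | rfl | rfl | rfl <;> simp at h <;>
      rcases hf' with rfl | rfl | rfl | rfl <;> simp at h' ⊢ <;> omega

/-- The edges of level `n + 1` that lead from the centre of their cell away from `0`. -/
theorem orient_succ_eq_one {l : ℕ → ℕ} {n : ℕ} {c f : ℤ × ℤ} (hc : Center l (n + 1) c)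
    (hf : IsDir f) (h : orient l (n + 1) c f = 1) :
    ∃ b e, ∃ k : ℤ, Center l n b ∧ IsDir e ∧ 2 ∣ k ∧ 0 ≤ k ∧ k + 1 ≤ l n ∧
      c = (l n : ℤ) • b + k • e ∧
      ((f = e ∧ orient l n b e = 1) ∨ (2 ≤ k ∧ f = -e ∧ orient l n b e = -1) ∨
        (2 ≤ k ∧ e.1 * f.1 + e.2 * f.2 = 0)) := by
  cases hc with
  | @succ _ m b e hb he hm =>
    rw [orient_succ hb he hm] at h
    by_cases hm0 : m = 0
    · subst hm0
      simp only [if_true] at h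
      -- The central subcell lies on all axes; the one along the edge itself is chosen.
      exact ⟨b, f, 0, hb, hf, by simp, le_rfl, by omega, by simp, Or.inl ⟨rfl, h⟩⟩
    refine ⟨b, e, 2 * m, hb, he, by simp, by omega, by omega, rfl, ?_⟩
    simp only [hm0, if_false] at h
    rcases he with rfl | rfl | rfl | rfl <;> rcases hf with rfl | rfl | rfl | rfl <;>
      simp at h ⊢ <;> omega

theorem eq_or_two_mul_le {L a b : ℤ} (hL : 0 ≤ L) (ha : 2 ∣ a) (hb : 2 ∣ b) :
    a = b ∨ 2 * L ≤ L * a - L * b ∨ 2 * L ≤ L * b - L * a := by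
  rcases lt_trichotomy a b with h | h | h
  · right; right
    have : 2 ≤ b - a := by omega
    nlinarith
  · exact Or.inl h
  · right; left
    have : 2 ≤ a - b := by omega
    nlinarith

/-- The vertices reached stay in the box of half-width `L` around the scaled parent centre and touch
its boundary only at the tip of an axis. Distinct parents are `2 * L` apart in some coordinate, so a
vertex common to two of them is a tip for both. -/
theorem displacement_bound {L k : ℤ} {e f : ℤ × ℤ} (he : IsDir e) (hf : IsDir f) (hk : k + 1 ≤ L)
    (hk0 : 0 ≤ k) (h : f = e ∨ 2 ≤ k) :
    (-L ≤ k * e.1 + f.1 ∧ k * e.1 + f.1 ≤ L) ∧ (-L ≤ k * e.2 + f.2 ∧ k * e.2 + f.2 ≤ L) ∧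
      (¬ (k + 1 = L ∧ f = e) → (-L < k * e.1 + f.1 ∧ k * e.1 + f.1 < L) ∧
        (-L < k * e.2 + f.2 ∧ k * e.2 + f.2 < L)) := by
  rcases he with rfl | rfl | rfl | rfl <;> rcases hf with rfl | rfl | rfl | rfl <;>
    simp at h ⊢ <;> omega

/-- As `k` and `k'` are even, parity puts `f` and `f'` on the same axis. There remain a common
subcell, or two consecutive subcells of one axis facing each other. -/
theorem displacement_unique {k k' : ℤ} {e e' f f' : ℤ × ℤ} (he : IsDir e) (he' : IsDir e')
    (hf : IsDir f) (hf' : IsDir f') (hk2 : 2 ∣ k) (hk2' : 2 ∣ k') (hk : 0 ≤ k) (hk' : 0 ≤ k')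
    (h : f = e ∨ 2 ≤ k) (h' : f' = e' ∨ 2 ≤ k')
    (q1 : k * e.1 + f.1 = k' * e'.1 + f'.1) (q2 : k * e.2 + f.2 = k' * e'.2 + f'.2) :
    e = e' ∧ (k = k' ∨ (f = e ∧ f' = -e) ∨ (f' = e ∧ f = -e)) := by
  have hp1 : 2 ∣ f.1 - f'.1 := by
    have : f.1 - f'.1 = k' * e'.1 - k * e.1 := by linarith
    rw [this]
    exact (hk2'.mul_right _).sub (hk2.mul_right _)
  have hff : f' = f ∨ f' = -f := by
    clear h h' q1 q2
    rcases hf with rfl | rfl | rfl | rfl <;> rcases hf' with rfl | rfl | rfl | rfl <;>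
      simp at hp1 ⊢
  clear hp1 hk2 hk2' hf'
  rcases hff with rfl | rfl
  · simp only [add_left_inj] at q1 q2
    rcases he with rfl | rfl | rfl | rfl <;> rcases he' with rfl | rfl | rfl | rfl <;>
      simp at q1 q2 ⊢ <;> first | omega | skip
    all_goals
      rcases hf with rfl | rfl | rfl | rfl <;> simp at h h' <;> omega
  · rcases he with rfl | rfl | rfl | rfl <;> rcases hf with rfl | rfl | rfl | rfl <;>
      simp at q1 q2 h ⊢ <;>
    rcases he' with rfl | rfl | rfl | rfl <;> simp at q1 q2 h' ⊢ <;> omega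

/-- Two edges of level `n` that lead from the centres of their cells away from `0` do not end at
the same point. -/
theorem center_unique {l : ℕ → ℕ} (hl : ∀ k, Odd (l k) ∧ 3 ≤ l k) {n : ℕ} :
    ∀ {c c' e e' : ℤ × ℤ}, Center l n c → Center l n c' → IsDir e → IsDir e' →
      orient l n c e = 1 → orient l n c' e' = 1 → c + e = c' + e' → c = c' := by
  induction n with
  | zero => intro c c' e e' hc hc'; cases hc; cases hc'; simp
  | succ n ih =>
    intro c c' f f' hc hc' hf hf' h h' heq
    obtain ⟨b, e, k, hb, he, hk2, hk0, hkl, rfl, hcase⟩ := orient_succ_eq_one hc hf h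
    obtain ⟨b', e', k', hb', he', hk2', hk0', hkl', rfl, hcase'⟩ := orient_succ_eq_one hc' hf' h'
    obtain ⟨hodd, h3⟩ := hl n
    obtain ⟨j, hj⟩ := hodd
    have hL : (0 : ℤ) < l n := by omega
    have E1 := eq_or_two_mul_le hL.le hb.even.1 hb'.even.1
    have E2 := eq_or_two_mul_le hL.le hb.even.2 hb'.even.2
    have q1 := congrArg Prod.fst heq
    have q2 := congrArg Prod.snd heq
    simp only [Prod.fst_add, Prod.snd_add, Prod.smul_fst, Prod.smul_snd, smul_eq_mul] at q1 q2
    have hfe : f = e ∨ 2 ≤ k := hcase.imp And.left (Or.elim · And.left And.left)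
    have hfe' : f' = e' ∨ 2 ≤ k' := hcase'.imp And.left (Or.elim · And.left And.left)
    obtain ⟨D1, D2, D3⟩ := displacement_bound he hf hkl hk0 hfe
    obtain ⟨D1', D2', D3'⟩ := displacement_bound he' hf' hkl' hk0' hfe'
    have key : b = b' := by
      -- Different parents force both edges to be the last pieces of parent edges. These parent
      -- edges then end at a common point, to which the induction hypothesis applies.
      have : (b.1 = b'.1 ∧ b.2 = b'.2) ∨ (k + 1 = l n ∧ f = e) ∧ (k' + 1 = l n ∧ f' = e') := by
        by_cases hD : k + 1 = l n ∧ f = e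
        · by_cases hD' : k' + 1 = l n ∧ f' = e'
          · exact Or.inr ⟨hD, hD'⟩
          · have := D3' hD'
            left; omega
        · have := D3 hD
          left; omega
      rcases this with ⟨h1, h2⟩ | ⟨⟨h1, h2⟩, h3, h4⟩
      · exact Prod.ext h1 h2
      · subst h2 h4
        have ho : orient l n b f = 1 := by
          rcases hcase with h | h | h
          · exact h.2
          · rcases hf with rfl | rfl | rfl | rfl <;> simp at h
          · rcases hf with rfl | rfl | rfl | rfl <;> simp at h
        have ho' : orient l n b' f' = 1 := by
          rcases hcase' with h | h | h
          · exact h.2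
          · rcases hf' with rfl | rfl | rfl | rfl <;> simp at h
          · rcases hf' with rfl | rfl | rfl | rfl <;> simp at h
        refine ih hb hb' hf hf' ho ho' (Prod.ext ?_ ?_)
        · refine mul_left_cancel₀ hL.ne' ?_
          have hk : k = l n - 1 := by omega
          have hk' : k' = l n - 1 := by omega
          rw [hk, hk'] at q1
          simp only [Prod.fst_add]
          linarith
        · refine mul_left_cancel₀ hL.ne' ?_
          have hk : k = l n - 1 := by omega
          have hk' : k' = l n - 1 := by omega
          rw [hk, hk'] at q2
          simp only [Prod.snd_add]
          linarith
    subst key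
    -- With a common parent, two different subcells can share the end point only by facing each
    -- other along `e`. If both edges led to it, the axis would be oriented in both directions.
    have hs : ∀ e, ¬ (orient l n b e = 1 ∧ orient l n b e = -1) := fun e => by omega
    obtain ⟨rfl, h⟩ := displacement_unique he he' hf hf' hk2 hk2' hk0 hk0' hfe hfe'
      (by linarith : k * e.1 + f.1 = k' * e'.1 + f'.1)
      (by linarith : k * e.2 + f.2 = k' * e'.2 + f'.2)
    rcases h with rfl | ⟨rfl, rfl⟩ | ⟨rfl, rfl⟩
    · rfl
    · exfalso
      refine hs f ⟨?_, ?_⟩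
      · rcases hcase with h | h | h
        · exact h.2
        · rcases hf with rfl | rfl | rfl | rfl <;> simp at h
        · rcases hf with rfl | rfl | rfl | rfl <;> simp at h
      · rcases hcase' with h | h | h
        · rcases hf with rfl | rfl | rfl | rfl <;> simp at h
        · exact h.2.2
        · rcases hf with rfl | rfl | rfl | rfl <;> simp at h
    · exfalso
      refine hs f' ⟨?_, ?_⟩
      · rcases hcase' with h | h | h
        · exact h.2
        · rcases hf' with rfl | rfl | rfl | rfl <;> simp at h
        · rcases hf' with rfl | rfl | rfl | rfl <;> simp at h
      · rcases hcase with h | h | h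
        · rcases hf' with rfl | rfl | rfl | rfl <;> simp at h
        · exact h.2.2
        · rcases hf' with rfl | rfl | rfl | rfl <;> simp at h

theorem Center.arrow_or {l : ℕ → ℕ} {n : ℕ} {c e : ℤ × ℤ} (hc : Center l n c) (he : IsDir e) :
    Arrow l n c (c + e) ∨ Arrow l n (c + e) c := by
  rcases orient_eq hc e with h | h
  · exact Or.inl ⟨c, e, hc, he, Or.inl ⟨h, rfl, rfl⟩⟩
  · exact Or.inr ⟨c, e, hc, he, Or.inr ⟨h, rfl, rfl⟩⟩

theorem Center.add_dir_ne {l : ℕ → ℕ} {n : ℕ} {c c' e : ℤ × ℤ} (hc : Center l n c)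
    (hc' : Center l n c') (he : IsDir e) : c + e ≠ c' := by
  rintro rfl
  have h1 := hc.even
  have h2 := hc'.even
  rcases he with rfl | rfl | rfl | rfl <;> simp at h2 <;> omega

/-- At most one edge leads into each vertex. -/
theorem Arrow.unique {l : ℕ → ℕ} (hl : ∀ k, Odd (l k) ∧ 3 ≤ l k) {n : ℕ} {a a' b : ℤ × ℤ}
    (h : Arrow l n a b) (h' : Arrow l n a' b) : a = a' := by
  obtain ⟨c, e, hc, he, ⟨ho, rfl, rfl⟩ | ⟨ho, rfl, rfl⟩⟩ := h <;>
    obtain ⟨c', e', hc', he', ⟨ho', rfl, h⟩ | ⟨ho', rfl, h⟩⟩ := h'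
  · exact center_unique hl hc hc' he he' ho ho' h
  · exact absurd h (hc.add_dir_ne hc' he)
  · exact absurd h.symm (hc'.add_dir_ne hc he')
  · subst h
    rw [orient_neg_unique hc he he' ho ho']

theorem center_zero (l : ℕ → ℕ) (hl : ∀ k, Odd (l k) ∧ 3 ≤ l k) (n : ℕ) : Center l n 0 := by
  induction n with
  | zero => exact .zero
  | succ n ih =>
    have := hl n
    simpa using Center.succ (m := 0) ih (Or.inl rfl) (by omega)

theorem not_arrow_zero {l : ℕ → ℕ} (hl : ∀ k, Odd (l k) ∧ 3 ≤ l k) {n : ℕ} {a : ℤ × ℤ} :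
    ¬ Arrow l n a 0 := by
  rintro ⟨c, e, hc, he, ⟨ho, rfl, h⟩ | ⟨ho, rfl, rfl⟩⟩
  · exact hc.add_dir_ne (center_zero l hl n) he h.symm
  · rw [orient_zero l hl] at ho
    omega

/-- The piece between `k` and `k + 1` belongs to the subcell centred at the even one of the two
numbers. For odd `k` it points back from that centre; the sign of `orient` and the order of the end
points both flip, and the two changes cancel. -/
theorem arrow_axis {l : ℕ → ℕ} (hl : ∀ k, Odd (l k) ∧ 3 ≤ l k) {n : ℕ} {c e : ℤ × ℤ}
    (hc : Center l n c) (he : IsDir e) {k : ℕ} (hk : k < l n) :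
    (orient l n c e = 1 → Arrow l (n + 1) ((l n : ℤ) • c + (k : ℤ) • e)
      ((l n : ℤ) • c + (k + 1 : ℤ) • e)) ∧
    (orient l n c e = -1 → Arrow l (n + 1) ((l n : ℤ) • c + (k + 1 : ℤ) • e)
      ((l n : ℤ) • c + (k : ℤ) • e)) := by
  obtain ⟨⟨j, hj⟩, -⟩ := hl n
  have hee : e.1 * e.1 + e.2 * e.2 = 1 := by rcases he with rfl | rfl | rfl | rfl <;> rfl
  rcases Nat.even_or_odd' k with ⟨m, rfl | rfl⟩
  · have hm : 2 * m + 1 ≤ l n := by omega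
    have ho : orient l (n + 1) ((l n : ℤ) • c + (2 * m : ℤ) • e) e = orient l n c e := by
      rw [orient_succ hc he hm, hee]
      simp
    have hs : (l n : ℤ) • c + (2 * m : ℤ) • e + e = (l n : ℤ) • c + (2 * m + 1 : ℤ) • e := by
      rw [add_smul, one_smul, add_assoc]
    push_cast
    constructor
    · intro h
      exact ⟨_, e, hc.succ he hm, he, Or.inl ⟨by rw [ho, h], rfl, hs.symm⟩⟩
    · intro h
      exact ⟨_, e, hc.succ he hm, he, Or.inr ⟨by rw [ho, h], hs.symm, rfl⟩⟩
  · have hm : 2 * (m + 1) + 1 ≤ l n := by omega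
    have ho : orient l (n + 1) ((l n : ℤ) • c + (2 * (m + 1 : ℕ) : ℤ) • e) (-e)
        = - orient l n c e := by
      rw [orient_succ hc he hm]
      have : e.1 * (-e).1 + e.2 * (-e).2 = -1 := by simp; linarith
      rw [this]
      simp
    have hs : (l n : ℤ) • c + (2 * (m + 1 : ℕ) : ℤ) • e + -e
        = (l n : ℤ) • c + (2 * m + 1 : ℤ) • e := by
      push_cast
      module
    have hs' : (2 * (m : ℤ) + 1 + 1) = 2 * (m + 1 : ℕ) := by push_cast; ring
    rw [show ((2 * m + 1 : ℕ) : ℤ) = 2 * m + 1 by push_cast; rfl]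
    rw [hs']
    constructor
    · intro h
      exact ⟨_, -e, hc.succ he hm, he.neg, Or.inr ⟨by rw [ho, h], hs.symm, rfl⟩⟩
    · intro h
      exact ⟨_, -e, hc.succ he hm, he.neg, Or.inl ⟨by rw [ho, h]; simp, rfl, hs.symm⟩⟩

/-- The parts of level `n + 1` of an edge of level `n` have the same orientation as that edge. -/
theorem Arrow.subdivide {l : ℕ → ℕ} (hl : ∀ k, Odd (l k) ∧ 3 ≤ l k) {n : ℕ} {a b : ℤ × ℤ}
    (h : Arrow l n a b) {k : ℕ} (hk : k < l n) :
    Arrow l (n + 1) ((l n : ℤ) • a + (k : ℤ) • (b - a))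
      ((l n : ℤ) • a + (k + 1 : ℤ) • (b - a)) := by
  obtain ⟨c, e, hc, he, ⟨ho, rfl, rfl⟩ | ⟨ho, rfl, rfl⟩⟩ := h
  · rw [add_sub_cancel_left]
    exact (arrow_axis hl hc he hk).1 ho
  · have h := (arrow_axis hl hc he (k := l n - 1 - k) (by omega)).2 ho
    have hc1 : ((l n - 1 - k : ℕ) : ℤ) = l n - 1 - k := by omega
    rw [hc1] at h
    convert h using 1 <;> module

theorem finite_center (l : ℕ → ℕ) (n : ℕ) : {c | Center l n c}.Finite := by
  induction n with
  | zero =>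
    refine (Set.finite_singleton 0).subset ?_
    rintro c ⟨⟩
    rfl
  | succ n ih =>
    have hdir : {e | IsDir e}.Finite := by
      refine (Set.toFinite {(1, 0), (0, 1), (-1, 0), (0, -1)}).subset ?_
      rintro e he
      simpa [IsDir] using he
    refine ((ih.prod (hdir.prod (Set.finite_Iic (l n)))).image
      fun x => (l n : ℤ) • x.1 + (2 * x.2.2 : ℤ) • x.2.1).subset ?_
    rintro c hc
    cases hc with
    | @succ _ m c e hc he hm =>
      exact ⟨(c, e, m), ⟨hc, he, by simp; omega⟩, rfl⟩

/-! ### Arrows and graph distance -/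

/-- If at most one arrow leads into each vertex of a graph and none into `r`, then the arrows
point away from `r`. -/
theorem dist_eq_of_arrows {α : Type*} {G : SimpleGraph α} {r : α} {O : α → α → Prop}
    (hadj : ∀ x y, G.Adj x y → O x y ∨ O y x) (hin : ∀ x y z, O x z → O y z → x = y)
    (h0 : ∀ x, ¬ O x r) {x y : α} (h : O x y) (hy : G.Reachable r y) :
    G.dist r y = G.dist r x + 1 := by
  have key : ∀ k y, G.Reachable r y → y ≠ r → G.dist r y = k →
      ∃ x, O x y ∧ G.dist r x + 1 = k := by
    intro k
    induction k with
    | zero =>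
      intro y hy hne hd
      exact absurd (hy.dist_eq_zero_iff.1 hd).symm hne
    | succ k ih =>
      intro y hy hne hd
      obtain ⟨w, hw⟩ := hy.symm.exists_walk_length_eq_dist
      cases w with
      | nil => exact absurd rfl hne
      | @cons _ x _ hyx w =>
        rw [SimpleGraph.dist_comm, hd, SimpleGraph.Walk.length_cons] at hw
        have h1 : G.dist r x ≤ k := by
          rw [SimpleGraph.dist_comm]
          exact (SimpleGraph.dist_le w).trans (by omega)
        have h2 : G.dist r y ≤ G.dist r x + 1 := by
          obtain ⟨w', hw'⟩ := w.reachable.symm.exists_walk_length_eq_dist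
          rw [← hw', ← SimpleGraph.Walk.length_concat w' hyx.symm]
          exact SimpleGraph.dist_le _
        have h3 : G.dist r x = k := by omega
        -- Here `x` follows `y` on a geodesic to `r`. An arrow from `y` to `x` would exclude `x = r`
        -- and be the only arrow into `x`, but by induction `x` is entered from a vertex closer to
        -- `r`.
        rcases hadj _ _ hyx.symm with ho | ho
        · exact ⟨x, ho, by omega⟩
        · obtain ⟨z, hz, hzd⟩ := ih x w.reachable.symm (fun hx => h0 y (hx ▸ ho)) h3
          have := hin _ _ _ hz ho
          subst this
          omega
  obtain ⟨x', hx', hd⟩ := key _ y hy (fun hyr => h0 x (hyr ▸ h)) rfl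
  rw [hin _ _ _ h hx', hd]

/-! ### Vertices in the plane, adjacency and the order `≺` -/

/-- The point of the plane with lattice coordinates `a` at level `n`. -/
noncomputable def point (l : ℕ → ℕ) (n : ℕ) (a : ℤ × ℤ) : ℂ :=
  (edgeLength l n : ℂ) * (((a.1 : ℂ) + (a.2 : ℂ) * Complex.I) * q 1)

theorem edgeLength_pos {l : ℕ → ℕ} (hl : ∀ k, Odd (l k) ∧ 3 ≤ l k) (n : ℕ) :
    0 < edgeLength l n :=
  Finset.prod_pos fun k _ => by
    have := (hl k).2
    positivity

theorem edgeLength_succ (l : ℕ → ℕ) (n : ℕ) :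
    edgeLength l (n + 1) = edgeLength l n * ((l n : ℝ))⁻¹ :=
  Finset.prod_range_succ _ _

theorem edgeLength_tendsto {l : ℕ → ℕ} (hl : ∀ k, Odd (l k) ∧ 3 ≤ l k) :
    Filter.Tendsto (edgeLength l) Filter.atTop (nhds 0) := by
  have h : ∀ n, edgeLength l n ≤ (3⁻¹ : ℝ) ^ n := by
    intro n
    have : (3⁻¹ : ℝ) ^ n = ∏ _k ∈ Finset.range n, (3⁻¹ : ℝ) := by simp
    rw [edgeLength, this]
    refine Finset.prod_le_prod (fun k _ => by positivity) fun k _ => ?_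
    have : (3 : ℝ) ≤ l k := by exact_mod_cast (hl k).2
    gcongr
  exact squeeze_zero (fun n => (edgeLength_pos hl n).le) h
    (tendsto_pow_atTop_nhds_zero_of_lt_one (by norm_num) (by norm_num))

theorem norm_q_one : ‖q 1‖ = 1 := by
  rw [q, if_neg one_ne_zero, Complex.norm_exp]
  simp

theorem q_one_ne_zero : q 1 ≠ 0 := norm_ne_zero_iff.1 (by simp [norm_q_one])

theorem q_succ {j : ℕ} (hj : j ≠ 0) : q (j + 1) = Complex.I * q j := by
  have hI : Complex.I = Complex.exp ((Real.pi : ℂ) / 2 * Complex.I) := by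
    rw [Complex.exp_mul_I, Complex.cos_pi_div_two, Complex.sin_pi_div_two]
    simp
  rw [q, q, if_neg hj, if_neg (by omega)]
  nth_rewrite 2 [hI]
  rw [← Complex.exp_add]
  push_cast
  ring_nf

theorem exists_q_iff (z : ℂ) : (∃ j : ℕ, 1 ≤ j ∧ j ≤ 4 ∧ z = q j) ↔
    ∃ e, IsDir e ∧ z = ((e.1 : ℂ) + (e.2 : ℂ) * Complex.I) * q 1 := by
  have h2 : q 2 = Complex.I * q 1 := q_succ (by norm_num)
  have h3 : q 3 = -q 1 := by rw [q_succ (by norm_num), h2, ← mul_assoc, Complex.I_mul_I]; ring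
  have h4 : q 4 = - (Complex.I * q 1) := by rw [q_succ (by norm_num), h3]; ring
  constructor
  · rintro ⟨j, h1, hj, rfl⟩
    interval_cases j
    · exact ⟨(1, 0), by simp [IsDir], by simp⟩
    · exact ⟨(0, 1), by simp [IsDir], by simp [h2]⟩
    · exact ⟨(-1, 0), by simp [IsDir], by simp [h3]⟩
    · exact ⟨(0, -1), by simp [IsDir], by simp [h4]⟩
  · rintro ⟨e, rfl | rfl | rfl | rfl, rfl⟩
    · exact ⟨1, by simp⟩
    · exact ⟨2, by simp [h2]⟩
    · exact ⟨3, by simp [h3]⟩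
    · exact ⟨4, by simp [h4]⟩

theorem point_add (l : ℕ → ℕ) (n : ℕ) (a b : ℤ × ℤ) :
    point l n (a + b) = point l n a + point l n b := by
  simp only [point, Prod.fst_add, Prod.snd_add]
  push_cast
  ring

theorem point_smul (l : ℕ → ℕ) (n : ℕ) (k : ℤ) (a : ℤ × ℤ) :
    point l n (k • a) = k * point l n a := by
  simp only [point, Prod.smul_fst, Prod.smul_snd, smul_eq_mul]
  push_cast
  ring

theorem point_sub (l : ℕ → ℕ) (n : ℕ) (a b : ℤ × ℤ) :
    point l n (a - b) = point l n a - point l n b := by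
  simp only [point, Prod.fst_sub, Prod.snd_sub]
  push_cast
  ring

theorem point_zero (l : ℕ → ℕ) (n : ℕ) : point l n 0 = 0 := by simp [point]

theorem point_succ (l : ℕ → ℕ) (n : ℕ) (a : ℤ × ℤ) :
    point l (n + 1) a = (l n : ℂ)⁻¹ * point l n a := by
  simp only [point, edgeLength_succ]
  push_cast
  ring

theorem natCast_ne_zero {l : ℕ → ℕ} (hl : ∀ k, Odd (l k) ∧ 3 ≤ l k) (n : ℕ) : (l n : ℂ) ≠ 0 := by
  have := (hl n).2
  exact_mod_cast (by omega : l n ≠ 0)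

theorem point_succ_smul {l : ℕ → ℕ} (hl : ∀ k, Odd (l k) ∧ 3 ≤ l k) (n : ℕ) (a : ℤ × ℤ) :
    point l (n + 1) ((l n : ℤ) • a) = point l n a := by
  rw [point_smul, point_succ, Int.cast_natCast, mul_inv_cancel_left₀ (natCast_ne_zero hl n)]

theorem normSq_point (l : ℕ → ℕ) (n : ℕ) (a : ℤ × ℤ) :
    ‖point l n a‖ ^ 2 = edgeLength l n ^ 2 * ((a.1 ^ 2 + a.2 ^ 2 : ℤ) : ℝ) := by
  have h : ‖(a.1 : ℂ) + (a.2 : ℂ) * Complex.I‖ ^ 2 = (a.1 : ℝ) ^ 2 + (a.2 : ℝ) ^ 2 := by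
    rw [← Complex.normSq_eq_norm_sq]
    simpa using Complex.normSq_add_mul_I a.1 a.2
  rw [point, norm_mul, norm_mul, norm_q_one, mul_one, mul_pow, h, Complex.norm_real,
    Real.norm_eq_abs, sq_abs]
  push_cast
  ring

theorem isDir_iff (e : ℤ × ℤ) : IsDir e ↔ e.1 ^ 2 + e.2 ^ 2 = 1 := by
  constructor
  · rintro (rfl | rfl | rfl | rfl) <;> rfl
  · intro h
    obtain ⟨x, y⟩ := e
    simp only at h
    have h1 : x ≤ 1 := by nlinarith
    have h2 : -1 ≤ x := by nlinarith
    have h3 : y ≤ 1 := by nlinarith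
    have h4 : -1 ≤ y := by nlinarith
    unfold IsDir
    interval_cases x <;> interval_cases y <;> simp at h ⊢

theorem point_injective {l : ℕ → ℕ} (hl : ∀ k, Odd (l k) ∧ 3 ≤ l k) (n : ℕ) :
    Function.Injective (point l n) := by
  intro a b h
  have h1 := normSq_point l n (a - b)
  rw [point_sub, h, sub_self, norm_zero] at h1
  have h2 := edgeLength_pos hl n
  have h3 : (a - b).1 ^ 2 + (a - b).2 ^ 2 = 0 := by
    have : (((a - b).1 ^ 2 + (a - b).2 ^ 2 : ℤ) : ℝ) = 0 := by
      rcases mul_eq_zero.1 (h1.symm.trans (by norm_num)) with h | h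
      · exact absurd h (by positivity)
      · exact h
    exact_mod_cast this
  have h4 : (a - b).1 = 0 := by nlinarith [sq_nonneg (a - b).1, sq_nonneg (a - b).2]
  have h5 : (a - b).2 = 0 := by nlinarith [sq_nonneg (a - b).1, sq_nonneg (a - b).2]
  exact sub_eq_zero.1 (Prod.ext h4 h5)

theorem dist_point_iff {l : ℕ → ℕ} (hl : ∀ k, Odd (l k) ∧ 3 ≤ l k) (n : ℕ) (a b : ℤ × ℤ) :
    dist (point l n a) (point l n b) = edgeLength l n ↔ IsDir (b - a) := by
  have h2 := edgeLength_pos hl n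
  rw [dist_comm, dist_eq_norm, ← point_sub, isDir_iff, ← sq_eq_sq₀ (norm_nonneg _) h2.le,
    normSq_point]
  have : edgeLength l n ^ 2 ≠ 0 := by positivity
  rw [mul_eq_left₀ this]
  exact_mod_cast Iff.rfl

theorem wordMap_eq (l : ℕ → ℕ) (w : ℕ → ℂ) (n : ℕ) (z : ℂ) :
    wordMap l w n z = wordMap l w n 0 + (edgeLength l n : ℂ) * z := by
  induction n generalizing z with
  | zero => simp [wordMap, edgeLength]
  | succ n ih =>
    simp only [wordMap, Function.comp_apply, contr]
    rw [ih, ih (w n + _), edgeLength_succ]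
    push_cast
    ring

theorem exists_center_of_mem_words {l : ℕ → ℕ} (hl : ∀ k, Odd (l k) ∧ 3 ≤ l k) {n : ℕ} {w : ℕ → ℂ}
    (hw : w ∈ words l n) : ∃ c, Center l n c ∧ wordMap l w n 0 = point l n c := by
  induction n with
  | zero => exact ⟨0, .zero, by simp [wordMap, point_zero]⟩
  | succ n ih =>
    obtain ⟨c, hc, hwc⟩ := ih fun k hk => hw k (by omega)
    obtain ⟨m, j, hm, h1, h4, hz⟩ := hw n (by omega)
    obtain ⟨e, he, hq⟩ := (exists_q_iff (q j)).1 ⟨j, h1, h4, rfl⟩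
    refine ⟨_, hc.succ he hm, ?_⟩
    rw [point_add, point_succ_smul hl, ← hwc]
    simp only [wordMap, Function.comp_apply, contr]
    rw [wordMap_eq, hz, hq, point_smul, point, edgeLength_succ]
    push_cast
    ring

theorem Center.exists_word {l : ℕ → ℕ} (hl : ∀ k, Odd (l k) ∧ 3 ≤ l k) {n : ℕ} {c : ℤ × ℤ}
    (hc : Center l n c) : ∃ w ∈ words l n, wordMap l w n 0 = point l n c := by
  induction hc with
  | zero => exact ⟨0, by simp [words], by simp [wordMap, point_zero]⟩
  | @succ n m c e hc he hm ih =>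
    obtain ⟨w, hw, hwc⟩ := ih
    obtain ⟨j, h1, h4, hq⟩ := (exists_q_iff _).2 ⟨e, he, rfl⟩
    -- The maps up to level `n` use only the letters before position `n`, so that letter is free to
    -- be changed.
    have hcongr : ∀ k ≤ n, ∀ a z, wordMap l (Function.update w n a) k z = wordMap l w k z := by
      intro k
      induction k with
      | zero => intros; rfl
      | succ k ih =>
        intro hk a z
        simp only [wordMap, Function.comp_apply]
        rw [Function.update_of_ne (by omega), ih (by omega)]
    refine ⟨Function.update w n (2 * (m : ℂ) * (l n : ℂ)⁻¹ * q j), ?_, ?_⟩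
    · intro k hk
      rcases eq_or_ne k n with rfl | hne
      · rw [Function.update_self]
        exact ⟨m, j, hm, h1, h4, rfl⟩
      · rw [Function.update_of_ne hne]
        exact hw k (by omega)
    · rw [point_add, point_succ_smul hl, ← hwc]
      simp only [wordMap, Function.comp_apply, contr]
      rw [hcongr n le_rfl, wordMap_eq, Function.update_self, ← hq, point_smul, point,
        edgeLength_succ]
      push_cast
      ring

theorem mem_V_iff {l : ℕ → ℕ} (hl : ∀ k, Odd (l k) ∧ 3 ≤ l k) (n : ℕ) (x : ℂ) :
    x ∈ V l n ↔ ∃ c, Center l n c ∧ (x = point l n c ∨ ∃ e, IsDir e ∧ x = point l n (c + e)) := by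
  simp only [V, Set.mem_iUnion, Set.mem_image, Set.mem_ofPred_eq, exists_prop]
  constructor
  · rintro ⟨w, hw, _, ⟨j, hj, rfl⟩, rfl⟩
    obtain ⟨c, hc, hwc⟩ := exists_center_of_mem_words hl hw
    refine ⟨c, hc, ?_⟩
    rw [wordMap_eq, hwc]
    rcases Nat.eq_zero_or_pos j with rfl | hj0
    · left; simp [q]
    · right
      obtain ⟨e, he, hq⟩ := (exists_q_iff (q j)).1 ⟨j, hj0, hj, rfl⟩
      exact ⟨e, he, by rw [hq, point_add]; rfl⟩
  · rintro ⟨c, hc, h⟩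
    obtain ⟨w, hw, hwc⟩ := hc.exists_word hl
    rcases h with rfl | ⟨e, he, rfl⟩
    · exact ⟨w, hw, 0, ⟨0, by simp, by simp [q]⟩, hwc⟩
    · obtain ⟨j, h1, h4, hq⟩ := (exists_q_iff _).2 ⟨e, he, rfl⟩
      exact ⟨w, hw, q j, ⟨j, h4, rfl⟩, by rw [wordMap_eq, hwc, ← hq, point_add]; rfl⟩

theorem Center.point_mem {l : ℕ → ℕ} (hl : ∀ k, Odd (l k) ∧ 3 ≤ l k) {n : ℕ} {c : ℤ × ℤ}
    (hc : Center l n c) : point l n c ∈ V l n :=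
  (mem_V_iff hl n _).2 ⟨c, hc, Or.inl rfl⟩

theorem Center.point_add_mem {l : ℕ → ℕ} (hl : ∀ k, Odd (l k) ∧ 3 ≤ l k) {n : ℕ} {c e : ℤ × ℤ}
    (hc : Center l n c) (he : IsDir e) : point l n (c + e) ∈ V l n :=
  (mem_V_iff hl n _).2 ⟨c, hc, Or.inr ⟨e, he, rfl⟩⟩

theorem Center.adjacent {l : ℕ → ℕ} (hl : ∀ k, Odd (l k) ∧ 3 ≤ l k) {n : ℕ} {c e : ℤ × ℤ}
    (hc : Center l n c) (he : IsDir e) : Adjacent l n (point l n c) (point l n (c + e)) :=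
  ⟨hc.point_mem hl, hc.point_add_mem hl he, (dist_point_iff hl n _ _).2 (by simpa using he)⟩

theorem Adjacent.symm {l : ℕ → ℕ} {n : ℕ} {x y : ℂ} (h : Adjacent l n x y) : Adjacent l n y x :=
  ⟨h.2.1, h.1, by rw [dist_comm, h.2.2]⟩

/-- The adjacent pairs are the edges within the cells. -/
theorem adjacent_iff {l : ℕ → ℕ} (hl : ∀ k, Odd (l k) ∧ 3 ≤ l k) (n : ℕ) (x y : ℂ) :
    Adjacent l n x y ↔ ∃ c e, Center l n c ∧ IsDir e ∧
      ((x = point l n c ∧ y = point l n (c + e)) ∨ (x = point l n (c + e) ∧ y = point l n c)) := by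
  constructor
  · rintro ⟨hx, hy, hd⟩
    obtain ⟨c, hc, hx⟩ := (mem_V_iff hl n _).1 hx
    obtain ⟨c', hc', hy⟩ := (mem_V_iff hl n _).1 hy
    have h1 := hc.even
    have h2 := hc'.even
    -- The coordinates of a centre have even sum, those of the outer vertices of a cell odd sum, and
    -- a unit step changes the parity. So exactly one of two adjacent points is a centre, and the
    -- other is then a vertex of that very cell.
    rcases hx with rfl | ⟨e, he, rfl⟩ <;> rcases hy with rfl | ⟨e', he', rfl⟩ <;>
      rw [dist_point_iff hl] at hd
    · exfalso
      rcases hd with h | h | h | h <;> rw [Prod.ext_iff] at h <;> simp at h <;> omega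
    · exact ⟨c, _, hc, hd, Or.inl ⟨rfl, by rw [add_sub_cancel]⟩⟩
    · exact ⟨c', _, hc', by simpa using hd.neg, Or.inr ⟨by rw [add_sub_cancel], rfl⟩⟩
    · exfalso
      rcases hd with h | h | h | h <;> rw [Prod.ext_iff] at h <;>
        rcases he with rfl | rfl | rfl | rfl <;> rcases he' with rfl | rfl | rfl | rfl <;>
        simp at h <;> omega
  · rintro ⟨c, e, hc, he, ⟨rfl, rfl⟩ | ⟨rfl, rfl⟩⟩
    · exact hc.adjacent hl he
    · exact (hc.adjacent hl he).symm

theorem adjacent_iff_arrow {l : ℕ → ℕ} (hl : ∀ k, Odd (l k) ∧ 3 ≤ l k) (n : ℕ) (x y : ℂ) :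
    Adjacent l n x y ↔
      ∃ a b, (Arrow l n a b ∨ Arrow l n b a) ∧ x = point l n a ∧ y = point l n b := by
  rw [adjacent_iff hl]
  constructor
  · rintro ⟨c, e, hc, he, ⟨rfl, rfl⟩ | ⟨rfl, rfl⟩⟩
    · exact ⟨c, c + e, hc.arrow_or he, rfl, rfl⟩
    · exact ⟨c + e, c, (hc.arrow_or he).symm, rfl, rfl⟩
  · rintro ⟨a, b, ⟨c, e, hc, he, ⟨-, rfl, rfl⟩ | ⟨-, rfl, rfl⟩⟩ |
      ⟨c, e, hc, he, ⟨-, rfl, rfl⟩ | ⟨-, rfl, rfl⟩⟩, rfl, rfl⟩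
    · exact ⟨_, _, hc, he, Or.inl ⟨rfl, rfl⟩⟩
    · exact ⟨_, _, hc, he, Or.inr ⟨rfl, rfl⟩⟩
    · exact ⟨_, _, hc, he, Or.inr ⟨rfl, rfl⟩⟩
    · exact ⟨_, _, hc, he, Or.inl ⟨rfl, rfl⟩⟩

theorem graph_adj_iff {l : ℕ → ℕ} (hl : ∀ k, Odd (l k) ∧ 3 ≤ l k) (n : ℕ) (x y : ℂ) :
    (graph l n).Adj x y ↔ Adjacent l n x y := by
  rw [graph, SimpleGraph.fromRel_adj]
  constructor
  · rintro ⟨-, h | h⟩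
    exacts [h, h.symm]
  · intro h
    refine ⟨?_, Or.inl h⟩
    rintro rfl
    have := h.2.2
    rw [dist_self] at this
    exact (edgeLength_pos hl n).ne this

theorem reachable_axis {l : ℕ → ℕ} (hl : ∀ k, Odd (l k) ∧ 3 ≤ l k) {n : ℕ} {c e : ℤ × ℤ}
    (hc : Center l n c) (he : IsDir e) {k : ℕ} (hk : k ≤ l n) :
    (graph l (n + 1)).Reachable (point l n c)
      (point l (n + 1) ((l n : ℤ) • c + (k : ℤ) • e)) := by
  induction k with
  | zero => rw [← point_succ_smul hl]; simp
  | succ k ih =>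
    refine (ih (by omega)).trans (SimpleGraph.Adj.reachable ?_)
    rw [graph_adj_iff hl, adjacent_iff_arrow hl]
    have h := arrow_axis hl hc he (k := k) (by omega)
    push_cast
    rcases orient_eq hc e with ho | ho
    · exact ⟨_, _, Or.inl (h.1 ho), rfl, rfl⟩
    · exact ⟨_, _, Or.inr (h.2 ho), rfl, rfl⟩

theorem reachable_lift {l : ℕ → ℕ} (hl : ∀ k, Odd (l k) ∧ 3 ≤ l k) {n : ℕ} {x y : ℂ}
    (h : (graph l n).Reachable x y) : (graph l (n + 1)).Reachable x y := by
  obtain ⟨w⟩ := h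
  induction w with
  | nil => rfl
  | cons hadj _ ih =>
    refine SimpleGraph.Reachable.trans ?_ ih
    have key : ∀ c e, Center l n c → IsDir e →
        (graph l (n + 1)).Reachable (point l n c) (point l n (c + e)) := by
      intro c e hc he
      have := reachable_axis hl hc he le_rfl
      rwa [← smul_add, point_succ_smul hl] at this
    rw [graph_adj_iff hl, adjacent_iff hl] at hadj
    obtain ⟨c, e, hc, he, ⟨rfl, rfl⟩ | ⟨rfl, rfl⟩⟩ := hadj
    · exact key c e hc he
    · exact (key c e hc he).symm

theorem reachable {l : ℕ → ℕ} (hl : ∀ k, Odd (l k) ∧ 3 ≤ l k) {n : ℕ} {x : ℂ}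
    (hx : x ∈ V l n) : (graph l n).Reachable 0 x := by
  have key : ∀ n c, Center l n c → (graph l n).Reachable 0 (point l n c) := by
    intro n c hc
    induction hc with
    | zero => rw [point_zero]
    | succ hc he hm ih =>
      have := reachable_axis hl hc he (Nat.le_of_succ_le hm)
      push_cast at this
      exact (reachable_lift hl ih).trans this
  obtain ⟨c, hc, rfl | ⟨e, he, rfl⟩⟩ := (mem_V_iff hl n _).1 hx
  · exact key n c hc
  · refine (key n c hc).trans (SimpleGraph.Adj.reachable ?_)
    rw [graph_adj_iff hl]
    exact hc.adjacent hl he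

/-- Arrows increase the distance to `0`, by uniqueness of the incoming arrow. Every adjacent pair
carries an arrow in one of the two directions, so strict inequality of distances singles out that
direction. -/
theorem prec_iff {l : ℕ → ℕ} (hl : ∀ k, Odd (l k) ∧ 3 ≤ l k) (n : ℕ) (x y : ℂ) :
    Prec l n x y ↔ ∃ a b, Arrow l n a b ∧ x = point l n a ∧ y = point l n b := by
  have key : ∀ a b, Arrow l n a b →
      (graph l n).dist 0 (point l n a) < (graph l n).dist 0 (point l n b) := by
    intro a b hab
    have hadj := (adjacent_iff_arrow hl n _ _).2 ⟨a, b, Or.inl hab, rfl, rfl⟩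
    have := dist_eq_of_arrows (G := graph l n) (r := 0)
      (O := fun x y => ∃ a b, Arrow l n a b ∧ x = point l n a ∧ y = point l n b)
      (x := point l n a) (y := point l n b) ?_ ?_ ?_ ⟨a, b, hab, rfl, rfl⟩ (reachable hl hadj.2.1)
    · omega
    · intro x y h
      rw [graph_adj_iff hl, adjacent_iff_arrow hl] at h
      obtain ⟨a, b, h | h, rfl, rfl⟩ := h
      · exact Or.inl ⟨a, b, h, rfl, rfl⟩
      · exact Or.inr ⟨b, a, h, rfl, rfl⟩
    · rintro x y z ⟨a, b, h, rfl, rfl⟩ ⟨a', b', h', rfl, hb⟩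
      obtain rfl := point_injective hl n hb
      rw [h.unique hl h']
    · rintro x ⟨a, b, h, rfl, hb⟩
      rw [← point_zero l n] at hb
      obtain rfl := point_injective hl n hb
      exact not_arrow_zero hl h
  constructor
  · rintro ⟨hadj, hlt⟩
    obtain ⟨a, b, h | h, rfl, rfl⟩ := (adjacent_iff_arrow hl n _ _).1 hadj
    · exact ⟨a, b, h, rfl, rfl⟩
    · exact absurd (key _ _ h) hlt.not_gt
  · rintro ⟨a, b, h, rfl, rfl⟩
    exact ⟨(adjacent_iff_arrow hl n _ _).2 ⟨a, b, Or.inl h, rfl, rfl⟩, key a b h⟩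

theorem Adjacent.prec_or {l : ℕ → ℕ} (hl : ∀ k, Odd (l k) ∧ 3 ≤ l k) {n : ℕ} {x y : ℂ}
    (h : Adjacent l n x y) : Prec l n x y ∨ Prec l n y x := by
  obtain ⟨a, b, hab | hab, rfl, rfl⟩ := (adjacent_iff_arrow hl n _ _).1 h
  · exact Or.inl ((prec_iff hl n _ _).2 ⟨a, b, hab, rfl, rfl⟩)
  · exact Or.inr ((prec_iff hl n _ _).2 ⟨b, a, hab, rfl, rfl⟩)

theorem Prec.dist_eq {l : ℕ → ℕ} {n : ℕ} {x y : ℂ} (h : Prec l n x y) :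
    dist x y = edgeLength l n := h.1.2.2

theorem Prec.not_symm {l : ℕ → ℕ} {n : ℕ} {x y : ℂ} (h : Prec l n x y) : ¬ Prec l n y x :=
  fun h' => h.2.not_gt h'.2

theorem finite_prec {l : ℕ → ℕ} (hl : ∀ k, Odd (l k) ∧ 3 ≤ l k) (n : ℕ) :
    {e : ℂ × ℂ | Prec l n e.1 e.2}.Finite := by
  have hV : (V l n).Finite := by
    have hdir : {e | IsDir e}.Finite := by
      refine (Set.toFinite {(1, 0), (0, 1), (-1, 0), (0, -1)}).subset ?_
      rintro e he
      simpa [IsDir] using he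
    refine (((finite_center l n).image (point l n)).union
      (((finite_center l n).prod hdir).image fun x => point l n (x.1 + x.2))).subset ?_
    intro x hx
    obtain ⟨c, hc, rfl | ⟨e, he, rfl⟩⟩ := (mem_V_iff hl n x).1 hx
    · exact Or.inl ⟨c, hc, rfl⟩
    · exact Or.inr ⟨(c, e), ⟨hc, he⟩, rfl⟩
  exact (hV.prod hV).subset fun e he => ⟨he.1.1, he.1.2.1⟩

/-! ### Subdivision of edges -/

/-- The number of edges of level `N` in an edge of level `n`. -/
def gridSize (l : ℕ → ℕ) (n N : ℕ) : ℕ := ∏ k ∈ Finset.Ico n N, l k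

theorem gridSize_mul {l : ℕ → ℕ} (hl : ∀ k, Odd (l k) ∧ 3 ≤ l k) {n N : ℕ} (h : n ≤ N) :
    gridSize l n N * edgeLength l N = edgeLength l n := by
  induction N, h using Nat.le_induction with
  | base => simp [gridSize]
  | succ N h ih =>
    have : (l N : ℝ) ≠ 0 := by exact_mod_cast natCast_ne_zero hl N
    rw [gridSize, Finset.prod_Ico_succ_top h, edgeLength_succ, ← ih, gridSize]
    push_cast
    field_simp

theorem gridSize_pos {l : ℕ → ℕ} (hl : ∀ k, Odd (l k) ∧ 3 ≤ l k) (n N : ℕ) :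
    0 < gridSize l n N :=
  Finset.prod_pos fun k _ => by have := (hl k).2; omega

theorem Prec.subdivide {l : ℕ → ℕ} (hl : ∀ k, Odd (l k) ∧ 3 ≤ l k) {n : ℕ} {x y : ℂ}
    (h : Prec l n x y) {k : ℕ} (hk : k < l n) :
    Prec l (n + 1) (AffineMap.lineMap x y ((k : ℝ) / l n))
      (AffineMap.lineMap x y (((k : ℝ) + 1) / l n)) := by
  obtain ⟨a, b, hab, rfl, rfl⟩ := (prec_iff hl n x y).1 h
  refine (prec_iff hl _ _ _).2 ⟨_, _, hab.subdivide hl hk, ?_, ?_⟩ <;>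
  · rw [point_add, point_succ_smul hl, point_smul, point_sub, point_succ, point_succ,
      AffineMap.lineMap_apply]
    simp
    ring

/-- All pieces of an edge keep its orientation, so the gradient identity holds without signs at
every scale. The induction writes the index as quotient and remainder modulo `l N`. -/
theorem Prec.grid {l : ℕ → ℕ} (hl : ∀ k, Odd (l k) ∧ 3 ≤ l k) {n N : ℕ} {x y : ℂ}
    (h : Prec l n x y) (hN : n ≤ N) {k : ℕ} (hk : k < gridSize l n N) :
    Prec l N (AffineMap.lineMap x y (k * edgeLength l N / edgeLength l n))
      (AffineMap.lineMap x y ((k + 1) * edgeLength l N / edgeLength l n)) := by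
  have hpos := edgeLength_pos hl
  induction N, hN using Nat.le_induction generalizing k with
  | base =>
    have : k = 0 := by simpa [gridSize] using hk
    subst this
    simpa [(hpos n).ne'] using h
  | succ N hN ih =>
    rw [gridSize, Finset.prod_Ico_succ_top hN] at hk
    have hk1 : k / l N < gridSize l n N := Nat.div_lt_of_lt_mul (by rwa [mul_comm] at hk)
    have hlN : 0 < l N := by have := (hl N).2; omega
    have h2 := (ih hk1).subdivide hl (Nat.mod_lt k hlN)
    have hkk : (k : ℝ) = l N * (k / l N : ℕ) + (k % l N : ℕ) := by
      exact_mod_cast (Nat.div_add_mod k (l N)).symm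
    have hn := (hpos n).ne'
    have hlR : (l N : ℝ) ≠ 0 := by exact_mod_cast hlN.ne'
    have key : ∀ s r : ℝ, AffineMap.lineMap
        (AffineMap.lineMap x y (s * edgeLength l N / edgeLength l n) : ℂ)
        (AffineMap.lineMap x y ((s + 1) * edgeLength l N / edgeLength l n)) (r / l N) =
        AffineMap.lineMap x y ((l N * s + r) * edgeLength l (N + 1) / edgeLength l n) := by
      intro s r
      rw [edgeLength_succ]
      have hn' : (edgeLength l n : ℂ) ≠ 0 := by exact_mod_cast hn
      have hlC : (l N : ℂ) ≠ 0 := by exact_mod_cast hlR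
      simp only [AffineMap.lineMap_apply, vsub_eq_sub, vadd_eq_add, Complex.real_smul]
      push_cast
      field_simp
      ring
    rw [key, key, ← hkk, ← add_assoc, ← hkk] at h2
    exact h2

theorem exists_grid_interval {l : ℕ → ℕ} (hl : ∀ k, Odd (l k) ∧ 3 ≤ l k) {n N : ℕ} (hN : n ≤ N)
    {t : ℝ} (h0 : 0 ≤ t) (h1 : t ≤ edgeLength l n) :
    ∃ k < gridSize l n N, k * edgeLength l N ≤ t ∧ t ≤ (k + 1) * edgeLength l N := by
  have hp := edgeLength_pos hl N
  have hM := gridSize_pos hl n N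
  rw [← gridSize_mul hl hN] at h1
  rcases h1.eq_or_lt with rfl | h1
  -- The right end of the edge goes to the last interval, since rounding down would give an index
  -- one too large.
  · refine ⟨gridSize l n N - 1, by omega, ?_⟩
    rw [Nat.cast_sub hM]
    constructor <;> push_cast <;> nlinarith
  · refine ⟨⌊t / edgeLength l N⌋₊, ?_, ?_, ?_⟩
    · rw [Nat.floor_lt (by positivity), div_lt_iff₀ hp]
      exact h1
    · exact (le_div_iff₀ hp).1 (Nat.floor_le (by positivity))
    · exact ((div_lt_iff₀ hp).1 (Nat.lt_floor_add_one _)).le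

/-! ### Cells, and edges as subsets of `K` -/

theorem q_mem_K0 {j : ℕ} (h1 : 1 ≤ j) (h4 : j ≤ 4) : q j ∈ K0 :=
  subset_convexHull ℝ _ ⟨j, h1, h4, rfl⟩

theorem dir_mem_K0 {e : ℤ × ℤ} (he : IsDir e) :
    ((e.1 : ℂ) + (e.2 : ℂ) * Complex.I) * q 1 ∈ K0 := by
  obtain ⟨j, h1, h4, h⟩ := (exists_q_iff _).2 ⟨e, he, rfl⟩
  rw [h]
  exact q_mem_K0 h1 h4

theorem convex_K0 : Convex ℝ K0 := convex_convexHull ℝ _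

theorem zero_mem_K0 : (0 : ℂ) ∈ K0 := by
  have h1 := dir_mem_K0 (e := (1, 0)) (by simp [IsDir])
  have h2 := dir_mem_K0 (e := (-1, 0)) (by simp [IsDir])
  have := convex_K0 h1 h2 (a := 1 / 2) (b := 1 / 2) (by norm_num) (by norm_num) (by norm_num)
  simpa using this

theorem norm_le_of_mem_K0 {z : ℂ} (hz : z ∈ K0) : ‖z‖ ≤ 1 := by
  have : K0 ⊆ Metric.closedBall (0 : ℂ) 1 := by
    refine convexHull_min ?_ (convex_closedBall _ _)
    rintro z hz
    obtain ⟨e, he, rfl⟩ := (exists_q_iff z).1 hz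
    rcases he with rfl | rfl | rfl | rfl <;> simp [norm_q_one]
  simpa using this hz

theorem contr_mem_K0 {L : ℕ} (hL : 3 ≤ L) {a z : ℂ} (ha : a ∈ S L) (hz : z ∈ K0) :
    contr L a z ∈ K0 := by
  obtain ⟨m, j, hm, h1, h4, rfl⟩ := ha
  have hL' : (0 : ℝ) < L := by positivity
  have hmR : (2 * m + 1 : ℝ) ≤ L := by exact_mod_cast hm
  have h2 : (0 : ℝ) ≤ L - (2 * m + 1) := by linarith
  -- The image point is the convex combination of `q j`, `z` and `0` with these weights; the last
  -- one is nonnegative because `2 * m + 1 ≤ L`.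
  have := convex_K0.sum_mem (t := Finset.univ) (w := ![2 * m / (L : ℝ), 1 / L, (L - (2 * m + 1)) / L])
    (z := ![q j, z, 0]) (by intro i _; fin_cases i <;> simp <;> positivity)
    (by rw [Fin.sum_univ_three]; simp; field_simp; ring)
    (by intro i _; fin_cases i; exacts [q_mem_K0 h1 h4, hz, zero_mem_K0])
  rw [Fin.sum_univ_three] at this
  convert this using 1
  simp only [contr, Matrix.cons_val_zero, Matrix.cons_val_one, Matrix.cons_val, smul_zero, add_zero,
    Complex.real_smul]
  push_cast
  ring

/-- The union of the cells of level `n`. -/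
noncomputable def cells (l : ℕ → ℕ) (n : ℕ) : Set ℂ := ⋃ w ∈ words l n, wordMap l w n '' K0

theorem mem_K_iff {l : ℕ → ℕ} {z : ℂ} : z ∈ K l ↔ ∀ n, 1 ≤ n → z ∈ cells l n := by
  simp [K, cells]

theorem mem_cells_iff {l : ℕ → ℕ} {n : ℕ} {z : ℂ} :
    z ∈ cells l n ↔ ∃ w ∈ words l n, ∃ a ∈ K0, wordMap l w n a = z := by
  simp [cells]

theorem cells_antitone {l : ℕ → ℕ} (hl : ∀ k, Odd (l k) ∧ 3 ≤ l k) : Antitone (cells l) := by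
  refine antitone_nat_of_succ_le fun n z hz => ?_
  obtain ⟨w, hw, a, ha, rfl⟩ := mem_cells_iff.1 hz
  exact mem_cells_iff.2 ⟨w, fun k hk => hw k (by omega), contr (l n) (w n) a,
    contr_mem_K0 (hl n).2 (hw n (by omega)) ha, rfl⟩

theorem Prec.exists_center {l : ℕ → ℕ} (hl : ∀ k, Odd (l k) ∧ 3 ≤ l k) {n : ℕ} {x y : ℂ}
    (h : Prec l n x y) : ∃ c e, Center l n c ∧ IsDir e ∧
      ((orient l n c e = 1 ∧ x = point l n c ∧ y = point l n (c + e)) ∨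
        (orient l n c e = -1 ∧ x = point l n (c + e) ∧ y = point l n c)) := by
  obtain ⟨a, b, ⟨c, e, hc, he, ⟨ho, rfl, rfl⟩ | ⟨ho, rfl, rfl⟩⟩, rfl, rfl⟩ := (prec_iff hl n x y).1 h
  · exact ⟨_, e, hc, he, Or.inl ⟨ho, rfl, rfl⟩⟩
  · exact ⟨_, e, hc, he, Or.inr ⟨ho, rfl, rfl⟩⟩

theorem Prec.segment_subset_cells {l : ℕ → ℕ} (hl : ∀ k, Odd (l k) ∧ 3 ≤ l k) {n : ℕ} {x y : ℂ}
    (h : Prec l n x y) : segment ℝ x y ⊆ cells l n := by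
  have key : ∀ c e, Center l n c → IsDir e →
      segment ℝ (point l n c) (point l n (c + e)) ⊆ cells l n := by
    rintro c e hc he _ ⟨s, t, hs, ht, hst, rfl⟩
    obtain ⟨w, hw, hwc⟩ := hc.exists_word hl
    refine mem_cells_iff.2 ⟨w, hw, _, convex_K0 zero_mem_K0 (dir_mem_K0 he) hs ht hst, ?_⟩
    rw [wordMap_eq, hwc, point_add]
    have : (s : ℂ) + t = 1 := by exact_mod_cast hst
    simp only [smul_zero, zero_add, Complex.real_smul]
    rw [show point l n e = edgeLength l n * ((e.1 + e.2 * Complex.I) * q 1) from rfl]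
    linear_combination - point l n c * this
  obtain ⟨c, e, hc, he, ⟨-, rfl, rfl⟩ | ⟨-, rfl, rfl⟩⟩ := h.exists_center hl
  · exact key c e hc he
  · rw [segment_symm]
    exact key c e hc he

theorem lineMap_mem_segment {x y : ℂ} {a b s : ℝ} (ha : a ≤ s) (hb : s ≤ b) :
    AffineMap.lineMap x y s ∈
      segment ℝ (AffineMap.lineMap x y a : ℂ) (AffineMap.lineMap x y b) := by
  have : s ∈ segment ℝ a b := by rw [segment_eq_Icc (ha.trans hb)]; exact ⟨ha, hb⟩
  rw [← image_segment ℝ (AffineMap.lineMap x y : ℝ →ᵃ[ℝ] ℂ)]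
  exact ⟨s, this, rfl⟩

/-- At every finer level the point lies on a piece of the edge, hence in a cell of that level. The
coarser levels follow because the unions of cells decrease. -/
theorem Prec.segment_subset {l : ℕ → ℕ} (hl : ∀ k, Odd (l k) ∧ 3 ≤ l k) {n : ℕ} {x y : ℂ}
    (h : Prec l n x y) : segment ℝ x y ⊆ K l := by
  intro z hz
  have hd := edgeLength_pos hl n
  have key : ∀ N, n ≤ N → z ∈ cells l N := by
    intro N hN
    rw [segment_eq_image_lineMap] at hz
    obtain ⟨s, ⟨h0, h1⟩, rfl⟩ := hz
    obtain ⟨k, hk, hk1, hk2⟩ := exists_grid_interval hl hN (t := s * edgeLength l n)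
      (by positivity) (by nlinarith)
    refine (h.grid hl hN hk).segment_subset_cells hl (lineMap_mem_segment ?_ ?_)
    · rwa [div_le_iff₀ hd]
    · rwa [le_div_iff₀ hd]
  refine mem_K_iff.2 fun m _ => ?_
  exact cells_antitone hl (le_max_right n m) (key _ (le_max_left n m))

theorem Prec.left_mem {l : ℕ → ℕ} (hl : ∀ k, Odd (l k) ∧ 3 ≤ l k) {n : ℕ} {x y : ℂ}
    (h : Prec l n x y) : x ∈ K l := h.segment_subset hl (left_mem_segment ℝ x y)

theorem Prec.right_mem {l : ℕ → ℕ} (hl : ∀ k, Odd (l k) ∧ 3 ≤ l k) {n : ℕ} {x y : ℂ}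
    (h : Prec l n x y) : y ∈ K l := h.segment_subset hl (right_mem_segment ℝ x y)

theorem V_subset {l : ℕ → ℕ} (hl : ∀ k, Odd (l k) ∧ 3 ≤ l k) (n : ℕ) : V l n ⊆ K l := by
  intro x hx
  obtain ⟨c, hc, rfl | ⟨e, he, rfl⟩⟩ := (mem_V_iff hl n x).1 hx
  · rcases (hc.adjacent hl (e := (1, 0)) (Or.inl rfl)).prec_or hl with h | h
    exacts [h.left_mem hl, h.right_mem hl]
  · rcases (hc.adjacent hl he).prec_or hl with h | h
    exacts [h.right_mem hl, h.left_mem hl]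

theorem exists_mem_V_dist_le {l : ℕ → ℕ} (hl : ∀ k, Odd (l k) ∧ 3 ≤ l k) {z : ℂ} (hz : z ∈ K l)
    {n : ℕ} (hn : 1 ≤ n) : ∃ v ∈ V l n, dist z v ≤ edgeLength l n := by
  obtain ⟨w, hw, a, ha, rfl⟩ := mem_cells_iff.1 (mem_K_iff.1 hz n hn)
  obtain ⟨c, hc, hwc⟩ := exists_center_of_mem_words hl hw
  refine ⟨_, hc.point_mem hl, ?_⟩
  have hd := edgeLength_pos hl n
  rw [wordMap_eq, hwc, dist_eq_norm, add_sub_cancel_left, norm_mul, Complex.norm_real,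
    Real.norm_of_nonneg hd.le]
  nlinarith [norm_le_of_mem_K0 ha]

/-! ### Edges of one level meet only at end points -/

/-- An inner point of an edge has one coordinate that is an even integer and one that is not an
integer and lies within distance `1` of the centre's even coordinate. These data determine the
centre and the direction. -/
theorem edge_coord_unique {c c' e e' : ℤ × ℤ} {t t' : ℝ} (hc : 2 ∣ c.1 ∧ 2 ∣ c.2)
    (hc' : 2 ∣ c'.1 ∧ 2 ∣ c'.2) (he : IsDir e) (he' : IsDir e') (h0 : 0 < t) (h1 : t < 1)
    (h0' : 0 ≤ t') (h1' : t' ≤ 1) (q1 : (c.1 : ℝ) + t * e.1 = c'.1 + t' * e'.1)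
    (q2 : (c.2 : ℝ) + t * e.2 = c'.2 + t' * e'.2) : c = c' ∧ e = e' := by
  obtain ⟨⟨a, ha⟩, ⟨b, hb⟩⟩ := hc
  obtain ⟨⟨a', ha'⟩, ⟨b', hb'⟩⟩ := hc'
  have key : a = a' ∧ b = b' ∧ e = e' := by
    rw [ha, ha'] at q1
    rw [hb, hb'] at q2
    push_cast at q1 q2
    have tri : ∀ i j : ℤ, i = j ∨ (i : ℝ) + 1 ≤ j ∨ (j : ℝ) + 1 ≤ i := by
      intro i j
      rcases lt_trichotomy i j with h | h | h
      · right; left; exact_mod_cast h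
      · left; exact h
      · right; right; exact_mod_cast h
    rcases tri a a' with rfl | h | h <;> rcases tri b b' with rfl | g | g <;>
    rcases he with rfl | rfl | rfl | rfl <;> rcases he' with rfl | rfl | rfl | rfl <;>
    first
      | exact ⟨rfl, rfl, rfl⟩
      | (exfalso; norm_num at q1 q2
         first | linarith | (subst q2; linarith) | (subst q1; linarith))
  obtain ⟨rfl, rfl, rfl⟩ := key
  exact ⟨Prod.ext (by omega) (by omega), rfl⟩

/-- An inner point of an edge lies on no other edge of the same level. -/
theorem Prec.unique {l : ℕ → ℕ} (hl : ∀ k, Odd (l k) ∧ 3 ≤ l k) {n : ℕ} {x y x' y' z : ℂ}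
    (h : Prec l n x y) (h' : Prec l n x' y') (hz : z ∈ openSegment ℝ x y)
    (hz' : z ∈ segment ℝ x' y') : x = x' ∧ y = y' := by
  obtain ⟨c, e, hc, he, hcase⟩ := h.exists_center hl
  obtain ⟨c', e', hc', he', hcase'⟩ := h'.exists_center hl
  have hzo : z ∈ openSegment ℝ (point l n c) (point l n (c + e)) := by
    rcases hcase with ⟨-, rfl, rfl⟩ | ⟨-, rfl, rfl⟩
    · exact hz
    · rwa [openSegment_symm]
  have hzo' : z ∈ segment ℝ (point l n c') (point l n (c' + e')) := by
    rcases hcase' with ⟨-, rfl, rfl⟩ | ⟨-, rfl, rfl⟩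
    · exact hz'
    · rwa [segment_symm]
  have hne : (edgeLength l n : ℂ) ≠ 0 := by exact_mod_cast (edgeLength_pos hl n).ne'
  have hform : ∀ (c e : ℤ × ℤ) (s t : ℝ), s + t = 1 →
      s • point l n c + t • point l n (c + e) = (edgeLength l n : ℂ) * ((((c.1 + t * e.1 : ℝ) : ℂ) +
        ((c.2 + t * e.2 : ℝ) : ℂ) * Complex.I) * q 1) := by
    intro c e s t hst
    have : (s : ℂ) = 1 - t := by rw [eq_sub_iff_add_eq]; exact_mod_cast hst
    simp only [Complex.real_smul, point, Prod.fst_add, Prod.snd_add, this]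
    push_cast
    ring
  obtain ⟨s, t, hs, ht, hst, rfl⟩ := hzo
  obtain ⟨s', t', hs', ht', hst', heq⟩ := hzo'
  rw [hform _ _ _ _ hst, hform _ _ _ _ hst'] at heq
  have heq2 := mul_right_cancel₀ q_one_ne_zero (mul_left_cancel₀ hne heq)
  have q1 := congrArg Complex.re heq2
  have q2 := congrArg Complex.im heq2
  simp only [Complex.add_re, Complex.add_im, Complex.ofReal_re, Complex.ofReal_im, Complex.mul_re,
    Complex.mul_im, Complex.I_re, Complex.I_im, mul_zero, mul_one, sub_zero, add_zero,
    zero_add] at q1 q2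
  obtain ⟨rfl, rfl⟩ := edge_coord_unique hc.even hc'.even he he' ht (by linarith) ht' (by linarith)
    q1.symm q2.symm
  rcases hcase with ⟨ho, rfl, rfl⟩ | ⟨ho, rfl, rfl⟩ <;>
    rcases hcase' with ⟨ho', rfl, rfl⟩ | ⟨ho', rfl, rfl⟩
  · exact ⟨rfl, rfl⟩
  · omega
  · omega
  · exact ⟨rfl, rfl⟩

/-- A function on `K` that takes the same value at adjacent vertices is constant on each `V_n`. -/
theorem eq_of_reachable {l : ℕ → ℕ} (hl : ∀ k, Odd (l k) ∧ 3 ≤ l k) {n : ℕ} {β : Type*}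
    {u : K l → β} (hu : ∀ x y : K l, Prec l n x y → u x = u y) {x y : ℂ}
    (h : (graph l n).Reachable x y) (hx : x ∈ K l) (hy : y ∈ K l) : u ⟨x, hx⟩ = u ⟨y, hy⟩ := by
  obtain ⟨w⟩ := h
  induction w with
  | nil => rfl
  | cons hadj _ ih =>
    rw [graph_adj_iff hl] at hadj
    have hv := V_subset hl n hadj.2.1
    rw [← ih hv hy]
    rcases hadj.prec_or hl with h | h
    · exact hu ⟨_, hx⟩ ⟨_, hv⟩ h
    · exact (hu ⟨_, hv⟩ ⟨_, hx⟩ h).symm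

/-! ### The length measure along edges -/

/-- The part of the segment `[x, y]` in `K`. -/
def edgeSet (l : ℕ → ℕ) (x y : ℂ) : Set (K l) := {z | (z : ℂ) ∈ segment ℝ x y}

theorem isClosed_edgeSet (l : ℕ → ℕ) (x y : ℂ) : IsClosed (edgeSet l x y) := by
  have : IsClosed (segment ℝ x y) := by
    rw [segment_eq_image_lineMap]
    exact (isCompact_Icc.image AffineMap.lineMap_continuous).isClosed
  exact this.preimage continuous_subtype_val

theorem measurableSet_edgeSet (l : ℕ → ℕ) (x y : ℂ) : MeasurableSet (edgeSet l x y) :=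
  (isClosed_edgeSet l x y).measurableSet

theorem skeleton_eq {l : ℕ → ℕ} (hl : ∀ k, Odd (l k) ∧ 3 ≤ l k) :
    {z : K l | (z : ℂ) ∈ skeleton l} =
      ⋃ n, ⋃ e ∈ {e : ℂ × ℂ | Prec l n e.1 e.2}, edgeSet l e.1 e.2 := by
  ext z
  simp only [Set.mem_iUnion, skeleton, edgeSet, Set.mem_ofPred_eq, exists_prop, Prod.exists]
  constructor
  · rintro ⟨n, x, y, h, hz⟩
    rcases h.prec_or hl with h | h
    · exact ⟨n, x, y, h, hz⟩
    · exact ⟨n, y, x, h, by rwa [segment_symm]⟩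
  · rintro ⟨n, x, y, h, hz⟩
    exact ⟨n, x, y, h.1, hz⟩

theorem measurableSet_skeleton {l : ℕ → ℕ} (hl : ∀ k, Odd (l k) ∧ 3 ≤ l k) :
    MeasurableSet {z : K l | (z : ℂ) ∈ skeleton l} := by
  rw [skeleton_eq hl]
  exact .iUnion fun n => .biUnion (finite_prec hl n).countable fun e _ =>
    measurableSet_edgeSet l e.1 e.2

theorem edgeCurve_mem {l : ℕ → ℕ} (hl : ∀ k, Odd (l k) ∧ 3 ≤ l k) {n : ℕ} {x y : ℂ} {t : ℝ} (ht : t ∈ Set.Icc 0 (edgeLength l n)) :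
    AffineMap.lineMap x y (t / edgeLength l n) ∈ segment ℝ x y := by
  have hd := edgeLength_pos hl n
  rw [segment_eq_image_lineMap]
  exact ⟨_, ⟨div_nonneg ht.1 hd.le, (div_le_one hd).2 ht.2⟩, rfl⟩

/-- The arc length parametrization of the edge from `x` to `y`, constant outside of
`[0, edgeLength l n]`. -/
noncomputable def edgeCurve {l : ℕ → ℕ} (hl : ∀ k, Odd (l k) ∧ 3 ≤ l k) {n : ℕ} {x y : ℂ}
    (h : Prec l n x y) (t : ℝ) : K l :=
  ⟨AffineMap.lineMap x y
    ((Set.projIcc 0 (edgeLength l n) (edgeLength_pos hl n).le t : ℝ) / edgeLength l n),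
    h.segment_subset hl (edgeCurve_mem hl (Subtype.mem _))⟩

theorem Prec.edgeSet_subset {l : ℕ → ℕ} {n : ℕ} {x y : ℂ} (h : Prec l n x y) :
    edgeSet l x y ⊆ {z : K l | (z : ℂ) ∈ skeleton l} :=
  fun _ hz => ⟨n, x, y, h.1, hz⟩

section
variable {l : ℕ → ℕ} (hl : ∀ k, Odd (l k) ∧ 3 ≤ l k) {n : ℕ} {x y : ℂ} (h : Prec l n x y)
include hl h

theorem edgeCurve_coe {t : ℝ} (ht : t ∈ Set.Icc 0 (edgeLength l n)) :
    (edgeCurve hl h t : ℂ) = AffineMap.lineMap x y (t / edgeLength l n) := by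
  simp only [edgeCurve, Set.projIcc_of_mem _ ht]

theorem continuous_edgeCurve : Continuous (edgeCurve hl h) := by
  refine Continuous.subtype_mk ?_ _
  exact AffineMap.lineMap_continuous.comp
    ((continuous_subtype_val.comp continuous_projIcc).div_const _)

theorem isometry_edgeCurve :
    Isometry fun t : Set.Icc 0 (edgeLength l n) => edgeCurve hl h t := by
  refine Isometry.of_dist_eq fun s t => ?_
  have hd := edgeLength_pos hl n
  rw [Subtype.dist_eq, edgeCurve_coe hl h s.2, edgeCurve_coe hl h t.2, dist_lineMap_lineMap,
    h.dist_eq, Subtype.dist_eq, Real.dist_eq, Real.dist_eq, ← sub_div, abs_div, abs_of_pos hd,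
    div_mul_cancel₀ _ hd.ne']

theorem range_edgeCurve :
    Set.range (fun t : Set.Icc 0 (edgeLength l n) => edgeCurve hl h t) = edgeSet l x y := by
  have hd := edgeLength_pos hl n
  ext z
  constructor
  · rintro ⟨t, rfl⟩
    simp only [edgeSet, Set.mem_ofPred_eq]
    rw [edgeCurve_coe hl h t.2]
    exact edgeCurve_mem hl t.2
  · intro hz
    simp only [edgeSet, Set.mem_ofPred_eq] at hz
    rw [segment_eq_image_lineMap] at hz
    obtain ⟨s, hs, hsz⟩ := hz
    have ht : s * edgeLength l n ∈ Set.Icc 0 (edgeLength l n) :=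
      ⟨mul_nonneg hs.1 hd.le, by nlinarith [hs.2]⟩
    refine ⟨⟨_, ht⟩, Subtype.ext ?_⟩
    rw [edgeCurve_coe hl h ht, mul_div_cancel_right₀ _ hd.ne', hsz]

/-- The arc length curve is an isometry on its interval, isometries transport Hausdorff measure, and
one-dimensional Hausdorff measure on the line is Lebesgue measure. -/
theorem restrict_edgeSet :
    (ν l).restrict (edgeSet l x y) =
      (volume.restrict (Set.Icc 0 (edgeLength l n))).map (edgeCurve hl h) := by
  have h1 := (isometry_edgeCurve hl h).map_hausdorffMeasure (d := 1) (Or.inl zero_le_one)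
  have h2 := (isometry_subtype_coe (s := Set.Icc 0 (edgeLength l n))).map_hausdorffMeasure
    (d := 1) (Or.inl zero_le_one)
  rw [Subtype.range_coe, hausdorffMeasure_real] at h2
  rw [range_edgeCurve hl h] at h1
  rw [ν, Measure.restrict_restrict_of_subset h.edgeSet_subset, ← h1, ← h2,
    Measure.map_map (continuous_edgeCurve hl h).measurable measurable_subtype_coe]
  rfl

theorem ae_edgeCurve {P : K l → Prop} (hP : ∀ᵐ z ∂(ν l), P z) :
    ∀ᵐ t ∂(volume.restrict (Set.Icc 0 (edgeLength l n))), P (edgeCurve hl h t) := by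
  have h1 : ∀ᵐ z ∂((ν l).restrict (edgeSet l x y)), P z := ae_restrict_of_ae hP
  rw [restrict_edgeSet hl h] at h1
  exact ae_of_ae_map (continuous_edgeCurve hl h).aemeasurable h1

theorem lintegral_edgeSet {f : K l → ℝ≥0∞} (hf : AEMeasurable f (ν l)) :
    ∫⁻ z in edgeSet l x y, f z ∂(ν l) =
      ∫⁻ t in Set.Icc 0 (edgeLength l n), f (edgeCurve hl h t) := by
  have hf' := hf.restrict (s := edgeSet l x y)
  rw [restrict_edgeSet hl h] at hf' ⊢
  exact lintegral_map' hf' (continuous_edgeCurve hl h).aemeasurable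

theorem setIntegral_edgeSet {f : K l → ℝ} (hf : AEStronglyMeasurable f (ν l)) :
    ∫ z in edgeSet l x y, f z ∂(ν l) =
      ∫ t in 0..edgeLength l n, f (edgeCurve hl h t) := by
  have hf' := hf.restrict (s := edgeSet l x y)
  rw [intervalIntegral.integral_of_le (edgeLength_pos hl n).le, ← integral_Icc_eq_integral_Ioc]
  rw [restrict_edgeSet hl h] at hf' ⊢
  exact integral_map (continuous_edgeCurve hl h).aemeasurable hf'

theorem nu_edgeSet : ν l (edgeSet l x y) = ENNReal.ofReal (edgeLength l n) := by
  have := lintegral_edgeSet hl h (f := 1) aemeasurable_const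
  simpa using this

end

/-- The skeleton is a countable union of edges. No measurability of `P` is needed: on an edge the
exceptional set is the isometric image of a null set. -/
theorem ae_of_edgeCurve {l : ℕ → ℕ} (hl : ∀ k, Odd (l k) ∧ 3 ≤ l k) {P : K l → Prop}
    (hP : ∀ n x y (h : Prec l n x y),
      ∀ᵐ t ∂(volume.restrict (Set.Icc 0 (edgeLength l n))), P (edgeCurve hl h t)) :
    ∀ᵐ z ∂(ν l), P z := by
  rw [ν, ae_restrict_iff' (measurableSet_skeleton hl), ae_iff]
  have hsub : {z : K l | ¬((z : ℂ) ∈ skeleton l → P z)} ⊆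
      ⋃ n, ⋃ e ∈ {e : ℂ × ℂ | Prec l n e.1 e.2}, (edgeSet l e.1 e.2 ∩ {z | ¬ P z}) := by
    intro z hz
    have hz' : (z : ℂ) ∈ skeleton l ∧ ¬ P z := by simpa using hz
    have h1 : z ∈ {z : K l | (z : ℂ) ∈ skeleton l} := hz'.1
    rw [skeleton_eq hl] at h1
    simp only [Set.mem_iUnion] at h1 ⊢
    obtain ⟨n, e, he, h1⟩ := h1
    exact ⟨n, e, he, h1, hz'.2⟩
  refine measure_mono_null hsub (measure_iUnion_null fun n =>
    (measure_biUnion_null_iff (finite_prec hl n).countable).2 fun e he => ?_)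
  have h1 := hP n e.1 e.2 he
  rw [ae_restrict_iff' measurableSet_Icc, ae_iff] at h1
  have h2 : edgeSet l e.1 e.2 ∩ {z | ¬ P z} = (fun t : Set.Icc 0 (edgeLength l n) =>
      edgeCurve hl he t) '' {t | ¬ P (edgeCurve hl he t)} := by
    rw [← range_edgeCurve hl he]
    ext z
    constructor
    · rintro ⟨⟨t, rfl⟩, hz⟩
      exact ⟨t, hz, rfl⟩
    · rintro ⟨t, ht, rfl⟩
      exact ⟨⟨t, rfl⟩, ht⟩
  rw [h2, (isometry_edgeCurve hl he).hausdorffMeasure_image (Or.inl zero_le_one),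
    ← isometry_subtype_coe.hausdorffMeasure_image (Or.inl zero_le_one), hausdorffMeasure_real]
  refine measure_mono_null ?_ h1
  rintro _ ⟨t, ht, rfl⟩
  exact fun hcon => ht (hcon t.2)

/-! ### Absolute continuity and differentiation on shrinking grids -/

open Filter Topology AbsolutelyContinuousOnInterval

theorem tendsto_floor_mul {δ : ℕ → ℝ} (hδ : ∀ N, 0 < δ N) (hδ0 : Tendsto δ atTop (𝓝 0)) {t : ℝ}
    (ht : 0 ≤ t) : Tendsto (fun N => (⌊t / δ N⌋₊ : ℝ) * δ N) atTop (𝓝 t) := by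
  have h1 : Tendsto (fun N => t - δ N) atTop (𝓝 t) := by simpa using hδ0.const_sub t
  refine tendsto_of_tendsto_of_tendsto_of_le_of_le h1 tendsto_const_nhds (fun N => ?_) fun N => ?_
  · have := (div_lt_iff₀ (hδ N)).1 (Nat.lt_floor_add_one (t / δ N))
    simp only
    linarith
  · exact (le_div_iff₀ (hδ N)).1 (Nat.floor_le (div_nonneg ht (hδ N).le))

/-- Rounding the end points down turns disjoint intervals into disjoint blocks of grid steps.
Hölder's inequality over these steps gives the bound, since their number times `δ` is the total
rounded length. -/
theorem grid_sum_bound {v : ℝ → ℝ} {p C δ : ℝ} (hp : 1 < p) (hδ : 0 < δ) {M : ℕ}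
    (hC : ∑ k ∈ Finset.range M, |v ((k + 1) * δ) - v (k * δ)| ^ p ≤ C * δ ^ (p - 1))
    {E : ℕ × (ℕ → ℝ × ℝ)} (hE : E ∈ disjWithin 0 (M * δ)) :
    (∑ i ∈ Finset.range E.1, |v (⌊max (E.2 i).1 (E.2 i).2 / δ⌋₊ * δ) -
        v (⌊min (E.2 i).1 (E.2 i).2 / δ⌋₊ * δ)|) ^ p ≤
      C * (∑ i ∈ Finset.range E.1, ((⌊max (E.2 i).1 (E.2 i).2 / δ⌋₊ : ℝ) * δ -
        (⌊min (E.2 i).1 (E.2 i).2 / δ⌋₊ : ℝ) * δ)) ^ (p - 1) := by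
  set A : ℕ → ℕ := fun i => ⌊min (E.2 i).1 (E.2 i).2 / δ⌋₊ with hA
  set B : ℕ → ℕ := fun i => ⌊max (E.2 i).1 (E.2 i).2 / δ⌋₊ with hB
  set d : ℕ → ℝ := fun k => v ((k + 1) * δ) - v (k * δ) with hd
  obtain ⟨hmem, hdisj⟩ := hE
  have hM : (0 : ℝ) ≤ M * δ := by positivity
  rw [Set.uIcc_of_le hM] at hmem
  have hmin : ∀ i ∈ Finset.range E.1, 0 ≤ min (E.2 i).1 (E.2 i).2 := fun i hi =>
    le_min (hmem i hi).1.1 (hmem i hi).2.1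
  have hmax : ∀ i ∈ Finset.range E.1, max (E.2 i).1 (E.2 i).2 ≤ M * δ := fun i hi =>
    max_le (hmem i hi).1.2 (hmem i hi).2.2
  have hAB : ∀ i, A i ≤ B i := fun i =>
    Nat.floor_le_floor (div_le_div_of_nonneg_right min_le_max hδ.le)
  -- A step is located by its right end, which lies in the half-open interval before rounding. Hence
  -- the blocks inherit disjointness from the intervals.
  have hpt : ∀ i ∈ Finset.range E.1, ∀ k ∈ Finset.Ico (A i) (B i),
      ((k + 1 : ℕ) : ℝ) * δ ∈ Set.uIoc (E.2 i).1 (E.2 i).2 := by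
    intro i hi k hk
    rw [Finset.mem_Ico] at hk
    constructor
    · rw [← div_lt_iff₀ hδ]
      exact (Nat.floor_lt (div_nonneg (hmin i hi) hδ.le)).1 (Nat.lt_succ_of_le hk.1)
    · rw [← le_div_iff₀ hδ]
      exact (Nat.le_floor_iff' (Nat.succ_ne_zero k)).1 hk.2
  have hdj : Set.PairwiseDisjoint (Finset.range E.1 : Set ℕ) fun i => Finset.Ico (A i) (B i) := by
    intro i hi j hj hij
    refine Finset.disjoint_left.2 fun k hki hkj => ?_
    exact Set.disjoint_left.1 (hdisj hi hj hij) (hpt i hi k hki) (hpt j hj k hkj)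
  set U : Finset ℕ := (Finset.range E.1).biUnion fun i => Finset.Ico (A i) (B i) with hU
  have hUM : U ⊆ Finset.range M := by
    intro k hk
    obtain ⟨i, hi, hk⟩ := Finset.mem_biUnion.1 hk
    have h1 := (hpt i hi k hk).2.trans (hmax i hi)
    have h2 : ((k + 1 : ℕ) : ℝ) ≤ M := le_of_mul_le_mul_right h1 hδ
    exact Finset.mem_range.2 (by exact_mod_cast h2)
  have hcard : (U.card : ℝ) * δ = ∑ i ∈ Finset.range E.1, ((B i : ℝ) * δ - (A i : ℝ) * δ) := by
    rw [hU, Finset.card_biUnion fun i hi j hj hij => hdj hi hj hij, Nat.cast_sum, Finset.sum_mul]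
    refine Finset.sum_congr rfl fun i _ => ?_
    rw [Nat.card_Ico, Nat.cast_sub (hAB i), sub_mul]
  have hsum : ∑ i ∈ Finset.range E.1, |v (B i * δ) - v (A i * δ)| ≤ ∑ k ∈ U, |d k| := by
    rw [hU, Finset.sum_biUnion hdj]
    refine Finset.sum_le_sum fun i _ => ?_
    have := dist_le_Ico_sum_dist (fun k : ℕ => v (k * δ)) (hAB i)
    simp only [Real.dist_eq] at this
    rw [abs_sub_comm]
    refine this.trans (Finset.sum_le_sum fun k _ => ?_)
    rw [abs_sub_comm, hd]
    push_cast
    exact le_rfl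
  calc _ ≤ (∑ k ∈ U, |d k|) ^ p :=
        Real.rpow_le_rpow (Finset.sum_nonneg fun _ _ => abs_nonneg _) hsum (by linarith)
    _ ≤ (U.card : ℝ) ^ (p - 1) * ∑ k ∈ U, |d k| ^ p :=
        Real.rpow_sum_le_const_mul_sum_rpow U d hp.le
    _ ≤ (U.card : ℝ) ^ (p - 1) * (C * δ ^ (p - 1)) := by
        gcongr
        refine (Finset.sum_le_sum_of_subset_of_nonneg hUM fun k _ _ => by positivity).trans hC
    _ = C * ((U.card : ℝ) * δ) ^ (p - 1) := by
        rw [Real.mul_rpow (by positivity) hδ.le]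
        ring
    _ = _ := by rw [hcard]

/-- A continuous function whose discrete `p`-energies on finer and finer grids are bounded is
absolutely continuous. -/
theorem absolutelyContinuous_of_grid {v : ℝ → ℝ} (hv : Continuous v) {p C D : ℝ} (hp : 1 < p)
    {δ : ℕ → ℝ} {M : ℕ → ℕ} (hδ : ∀ N, 0 < δ N) (hδ0 : Tendsto δ atTop (𝓝 0))
    (hM : ∀ N, M N * δ N = D)
    (hC : ∀ N, ∑ k ∈ Finset.range (M N), |v ((k + 1) * δ N) - v (k * δ N)| ^ p ≤
      C * δ N ^ (p - 1)) :
    AbsolutelyContinuousOnInterval v 0 D := by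
  have hC0 : 0 ≤ C := by
    have h1 : 0 ≤ C * δ 0 ^ (p - 1) :=
      (Finset.sum_nonneg fun k _ => by positivity).trans (hC 0)
    exact nonneg_of_mul_nonneg_left h1 (Real.rpow_pos_of_pos (hδ 0) _)
  have hD : 0 ≤ D := by
    rw [← hM 0]
    have := hδ 0
    positivity
  -- This is the limit of `grid_sum_bound`: the rounded end points converge to the true ones and `v`
  -- is continuous.
  have key : ∀ E ∈ disjWithin 0 D,
      (∑ i ∈ Finset.range E.1, dist (v (E.2 i).1) (v (E.2 i).2)) ^ p ≤
        C * (∑ i ∈ Finset.range E.1, dist (E.2 i).1 (E.2 i).2) ^ (p - 1) := by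
    intro E hE
    have hE1 := hE.1
    rw [Set.uIcc_of_le hD] at hE1
    have hmin : ∀ i ∈ Finset.range E.1, Tendsto
        (fun N => (⌊min (E.2 i).1 (E.2 i).2 / δ N⌋₊ : ℝ) * δ N) atTop
        (𝓝 (min (E.2 i).1 (E.2 i).2)) := fun i hi =>
      tendsto_floor_mul hδ hδ0 (le_min (hE1 i hi).1.1 (hE1 i hi).2.1)
    have hmax : ∀ i ∈ Finset.range E.1, Tendsto
        (fun N => (⌊max (E.2 i).1 (E.2 i).2 / δ N⌋₊ : ℝ) * δ N) atTop
        (𝓝 (max (E.2 i).1 (E.2 i).2)) := fun i hi =>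
      tendsto_floor_mul hδ hδ0 ((hE1 i hi).1.1.trans (le_max_left _ _))
    have hlim1 := tendsto_finsetSum (Finset.range E.1) fun i hi =>
      (((hv.tendsto _).comp (hmax i hi)).sub ((hv.tendsto _).comp (hmin i hi))).abs
    have hlim2 := tendsto_finsetSum (Finset.range E.1) fun i hi => (hmax i hi).sub (hmin i hi)
    have hle := le_of_tendsto_of_tendsto' (hlim1.rpow_const (p := p) (Or.inr (by linarith)))
      ((hlim2.rpow_const (p := p - 1) (Or.inr (by linarith))).const_mul C)
      fun N => grid_sum_bound hp (hδ N) (hC N) (by rwa [hM N])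
    have e1 : ∀ i, dist (v (E.2 i).1) (v (E.2 i).2) =
        |v (max (E.2 i).1 (E.2 i).2) - v (min (E.2 i).1 (E.2 i).2)| := by
      intro i
      rw [Real.dist_eq]
      rcases le_total (E.2 i).1 (E.2 i).2 with h | h
      · rw [max_eq_right h, min_eq_left h, abs_sub_comm]
      · rw [max_eq_left h, min_eq_right h]
    have e2 : ∀ i, dist (E.2 i).1 (E.2 i).2 =
        max (E.2 i).1 (E.2 i).2 - min (E.2 i).1 (E.2 i).2 := by
      intro i
      rw [Real.dist_eq, max_sub_min_eq_abs']
    simp only [e1, e2]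
    exact hle
  rw [absolutelyContinuousOnInterval_iff]
  intro ε hε
  have hp1 : 0 < p - 1 := by linarith
  -- The denominator `C + 1` allows `C = 0` and makes the final inequality strict.
  have hq : 0 < ε ^ p / (C + 1) := by positivity
  refine ⟨(ε ^ p / (C + 1)) ^ (p - 1)⁻¹, by positivity, fun E hE hlt => ?_⟩
  have h1 : (∑ i ∈ Finset.range E.1, dist (E.2 i).1 (E.2 i).2) ^ (p - 1) ≤ ε ^ p / (C + 1) := by
    refine (Real.rpow_le_rpow (Finset.sum_nonneg fun _ _ => dist_nonneg) hlt.le hp1.le).trans ?_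
    rw [Real.rpow_inv_rpow hq.le hp1.ne']
  have h2 : C * (ε ^ p / (C + 1)) < ε ^ p := by
    rw [← mul_div_assoc, div_lt_iff₀ (by positivity)]
    nlinarith [Real.rpow_pos_of_pos hε p]
  refine lt_of_not_ge fun hge => ?_
  have h3 := Real.rpow_le_rpow hε.le hge (by linarith : 0 ≤ p)
  exact absurd ((h3.trans (key E hE)).trans (mul_le_mul_of_nonneg_left h1 hC0)) h2.not_ge

/-- The difference quotients over intervals shrinking to a point tend to the derivative there. -/
theorem tendsto_straddle {v : ℝ → ℝ} {d t : ℝ} (hv : HasDerivAt v d t) {a b : ℕ → ℝ}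
    (ha : ∀ᶠ N in atTop, a N < t) (hb : ∀ᶠ N in atTop, t < b N)
    (hat : Tendsto a atTop (𝓝 t)) (hbt : Tendsto b atTop (𝓝 t)) :
    Tendsto (fun N => (v (b N) - v (a N)) / (b N - a N)) atTop (𝓝 d) := by
  rw [Metric.tendsto_nhds]
  intro ε hε
  have h := (hasDerivAt_iff_isLittleO.1 hv).def (half_pos hε)
  filter_upwards [hat.eventually h, hbt.eventually h, ha, hb] with N h1 h2 h3 h4
  simp only [smul_eq_mul, Real.norm_eq_abs] at h1 h2
  have hab : 0 < b N - a N := by linarith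
  rw [abs_of_neg (by linarith : a N - t < 0)] at h1
  rw [abs_of_pos (by linarith : 0 < b N - t)] at h2
  have : (v (b N) - v (a N)) / (b N - a N) - d =
      ((v (b N) - v t - (b N - t) * d) - (v (a N) - v t - (a N - t) * d)) / (b N - a N) := by
    field_simp
    ring
  rw [Real.dist_eq, this, abs_div, abs_of_pos hab, div_lt_iff₀ hab]
  have := abs_sub (v (b N) - v t - (b N - t) * d) (v (a N) - v t - (a N - t) * d)
  nlinarith

/-- An integrable function whose integrals over the intervals of finer and finer grids vanish is
zero almost everywhere. -/
theorem ae_eq_zero_of_grid {h : ℝ → ℝ} {D : ℝ} {δ : ℕ → ℝ} {M : ℕ → ℕ} (hδ : ∀ N, 0 < δ N)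
    (hδ0 : Tendsto δ atTop (𝓝 0)) (hM : ∀ N, M N * δ N = D) (hi : IntervalIntegrable h volume 0 D)
    (hz : ∀ N, ∀ k < M N, ∫ t in (k * δ N)..((k + 1) * δ N), h t = 0) :
    ∀ᵐ t ∂(volume.restrict (Set.Icc 0 D)), h t = 0 := by
  have hD : 0 ≤ D := by
    rw [← hM 0]
    have := hδ 0
    positivity
  have hmem : ∀ N, ∀ k ≤ M N, (k : ℝ) * δ N ∈ Set.uIcc 0 D := by
    intro N k hk
    have hk' : (k : ℝ) ≤ M N := by exact_mod_cast hk
    have := hδ N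
    rw [Set.uIcc_of_le hD, ← hM N]
    exact ⟨by positivity, by gcongr⟩
  have hgrid : ∀ N, ∀ k ≤ M N, ∫ t in 0..(k * δ N), h t = 0 := by
    intro N k hk
    have := intervalIntegral.sum_integral_adjacent_intervals (f := h) (μ := volume)
      (a := fun k : ℕ => (k : ℝ) * δ N) (n := k) fun j hj =>
        hi.mono_set (Set.uIcc_subset_uIcc (hmem N j (by omega)) (hmem N (j + 1) (by omega)))
    simp only [Nat.cast_zero, zero_mul] at this
    rw [← this]
    refine Finset.sum_eq_zero fun j hj => ?_
    have := hz N j (by have := Finset.mem_range.1 hj; omega)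
    push_cast
    exact this
  -- The primitive is continuous and vanishes at the grid points, which approximate every `t`.
  -- Differentiating it a.e. then recovers `h`.
  have hzero : ∀ t ∈ Set.Icc 0 D, ∫ s in 0..t, h s = 0 := by
    intro t ht
    have hcont : ContinuousOn (fun t => ∫ s in 0..t, h s) (Set.uIcc 0 D) :=
      intervalIntegral.continuousOn_primitive_interval' hi (by simp)
    have hfl : ∀ N, ⌊t / δ N⌋₊ ≤ M N := by
      intro N
      refine Nat.floor_le_of_le ?_
      rw [div_le_iff₀ (hδ N), hM N]
      exact ht.2
    have h1 : Tendsto (fun N => (⌊t / δ N⌋₊ : ℝ) * δ N) atTop (𝓝[Set.uIcc 0 D] t) :=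
      tendsto_nhdsWithin_iff.2 ⟨tendsto_floor_mul hδ hδ0 ht.1,
        Eventually.of_forall fun N => hmem N _ (hfl N)⟩
    have h2 := (hcont t (by rwa [Set.uIcc_of_le hD])).tendsto.comp h1
    refine tendsto_nhds_unique h2 ?_
    refine tendsto_const_nhds.congr fun N => (hgrid N _ (hfl N)).symm
  rw [ae_restrict_iff' measurableSet_Icc]
  have hne : ∀ᵐ t : ℝ, t ≠ 0 ∧ t ≠ D :=
    (Measure.ae_ne volume 0).and (Measure.ae_ne volume D)
  filter_upwards [hi.ae_hasDerivAt_integral, hne] with t ht hne hmem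
  have hd := ht (by rwa [Set.uIcc_of_le hD]) 0 (by simp)
  have hev : (fun t => ∫ s in 0..t, h s) =ᶠ[𝓝 t] fun _ => 0 := by
    filter_upwards [Icc_mem_nhds (lt_of_le_of_ne hmem.1 hne.1.symm) (lt_of_le_of_ne hmem.2 hne.2)]
      with s hs using hzero s hs
  exact (hd.congr_of_eventuallyEq hev.symm).unique (hasDerivAt_const t 0)

/-! ### Energies as sums over oriented edges -/

theorem finite_edges {l : ℕ → ℕ} (hl : ∀ k, Odd (l k) ∧ 3 ≤ l k) (n : ℕ) :
    {e : K l × K l | Prec l n e.1 e.2}.Finite := by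
  refine Set.Finite.of_finite_image (f := Prod.map Subtype.val Subtype.val)
    ((finite_prec hl n).subset ?_)
    (Function.Injective.prodMap Subtype.val_injective Subtype.val_injective).injOn
  rintro _ ⟨e, he, rfl⟩
  exact he

/-- The edges of level `n`, oriented away from `0`. -/
noncomputable def edges {l : ℕ → ℕ} (hl : ∀ k, Odd (l k) ∧ 3 ≤ l k) (n : ℕ) :
    Finset (K l × K l) := (finite_edges hl n).toFinset

section
variable {l : ℕ → ℕ} (hl : ∀ k, Odd (l k) ∧ 3 ≤ l k)

theorem mem_edges {n : ℕ} {e : K l × K l} : e ∈ edges hl n ↔ Prec l n e.1 e.2 := by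
  simp [edges]

include hl

theorem prod_rpow_eq (p : ℝ) (n : ℕ) :
    ∏ k ∈ Finset.range n, (l k : ℝ≥0∞) ^ (p - 1) = ENNReal.ofReal (edgeLength l n ^ (1 - p)) := by
  have hpos : ∀ k, (0 : ℝ) < l k := fun k => by have := (hl k).2; positivity
  rw [edgeLength, ← Real.finsetProd_rpow _ _ (fun k _ => by positivity),
    ENNReal.ofReal_prod_of_nonneg (fun k _ => by positivity)]
  refine Finset.prod_congr rfl fun k _ => ?_
  rw [Real.inv_rpow (hpos k).le, ← Real.rpow_neg (hpos k).le, neg_sub,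
    ← ENNReal.ofReal_rpow_of_pos (hpos k), ENNReal.ofReal_natCast]

/-- The factor one half cancels the two orderings of each edge, and the product of the scales is a
power of the edge length. -/
theorem discreteEnergy_eq (p : ℝ) (n : ℕ) (u : C(K l, ℝ)) :
    discreteEnergy l p n u =
      ∑ e ∈ edges hl n, ENNReal.ofReal (|u e.2 - u e.1| ^ p * edgeLength l n ^ (1 - p)) := by
  classical
  have hpos := edgeLength_pos hl n
  have hset : {e : K l × K l | Adjacent l n e.1 e.2} =
      ↑(edges hl n ∪ (edges hl n).map (Equiv.prodComm _ _).toEmbedding) := by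
    ext e
    simp only [Set.mem_ofPred_eq, Finset.coe_union, Set.mem_union, Finset.mem_coe, mem_edges,
      Finset.mem_map_equiv]
    constructor
    · exact fun h => h.prec_or hl
    · rintro (h | h)
      exacts [h.1, h.1.symm]
  have hdisj : Disjoint (edges hl n) ((edges hl n).map (Equiv.prodComm _ _).toEmbedding) := by
    rw [Finset.disjoint_left]
    intro e h1 h2
    rw [Finset.mem_map_equiv, mem_edges] at h2
    exact ((mem_edges hl).1 h1).not_symm h2
  have hsum : ∑' e : {e : K l × K l // Adjacent l n e.1 e.2},
      ENNReal.ofReal (|u e.1.1 - u e.1.2| ^ p) =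
      2 * ∑ e ∈ edges hl n, ENNReal.ofReal (|u e.2 - u e.1| ^ p) := by
    have h1 := tsum_congr_set_coe (fun e : K l × K l => ENNReal.ofReal (|u e.1 - u e.2| ^ p)) hset
    refine h1.trans ?_
    rw [Finset.tsum_subtype' _ fun e : K l × K l => ENNReal.ofReal (|u e.1 - u e.2| ^ p),
      Finset.sum_union hdisj, Finset.sum_map, two_mul]
    refine congrArg₂ _ (Finset.sum_congr rfl fun e _ => ?_) rfl
    rw [abs_sub_comm]
  rw [discreteEnergy, hsum, prod_rpow_eq hl, mul_comm 2⁻¹, mul_assoc, ← mul_assoc 2⁻¹,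
    ENNReal.inv_mul_cancel (by simp) (by simp), one_mul, Finset.mul_sum]
  refine Finset.sum_congr rfl fun e _ => ?_
  rw [mul_comm, ENNReal.ofReal_mul (by positivity)]

end

/-! ### Functions on `K` restricted to an edge -/

section
variable {l : ℕ → ℕ} (hl : ∀ k, Odd (l k) ∧ 3 ≤ l k) {n : ℕ} {x y : ℂ} (h : Prec l n x y)
include hl h

theorem injOn_edgeCurve : Set.InjOn (edgeCurve hl h) (Set.Icc 0 (edgeLength l n)) := by
  intro s hs t ht hst
  exact congrArg Subtype.val ((isometry_edgeCurve hl h).injective (a₁ := ⟨s, hs⟩) (a₂ := ⟨t, ht⟩) hst)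

theorem edgeCurve_zero : (edgeCurve hl h 0 : ℂ) = x := by
  rw [edgeCurve_coe hl h ⟨le_rfl, (edgeLength_pos hl n).le⟩]
  simp

theorem edgeCurve_edgeLength : (edgeCurve hl h (edgeLength l n) : ℂ) = y := by
  rw [edgeCurve_coe hl h ⟨(edgeLength_pos hl n).le, le_rfl⟩, div_self (edgeLength_pos hl n).ne']
  simp

omit h in
theorem grid_mem_Icc {N k : ℕ} (hN : n ≤ N) (hk : k ≤ gridSize l n N) :
    k * edgeLength l N ∈ Set.Icc 0 (edgeLength l n) := by
  have := edgeLength_pos hl N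
  have hk' : (k : ℝ) ≤ gridSize l n N := by exact_mod_cast hk
  rw [← gridSize_mul hl hN]
  exact ⟨by positivity, by gcongr⟩

omit h in
theorem grid_succ_mem_Icc {N k : ℕ} (hN : n ≤ N) (hk : k < gridSize l n N) :
    (k + 1) * edgeLength l N ∈ Set.Icc 0 (edgeLength l n) := by
  have := grid_mem_Icc hl (k := k + 1) hN hk
  push_cast at this
  exact this

theorem prec_edgeCurve {N k : ℕ} (hN : n ≤ N) (hk : k < gridSize l n N) :
    Prec l N (edgeCurve hl h (k * edgeLength l N)) (edgeCurve hl h ((k + 1) * edgeLength l N)) := by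
  rw [edgeCurve_coe hl h (grid_mem_Icc hl hN hk.le),
    edgeCurve_coe hl h (grid_succ_mem_Icc hl hN hk)]
  exact h.grid hl hN hk

theorem edgeCurve_mem_openSegment {a b t : ℝ} (ha : a ∈ Set.Icc 0 (edgeLength l n))
    (hb : b ∈ Set.Icc 0 (edgeLength l n)) (hat : a < t) (htb : t < b) :
    (edgeCurve hl h t : ℂ) ∈ openSegment ℝ (edgeCurve hl h a : ℂ) (edgeCurve hl h b) := by
  have hd := edgeLength_pos hl n
  rw [edgeCurve_coe hl h ha, edgeCurve_coe hl h hb,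
    edgeCurve_coe hl h ⟨ha.1.trans hat.le, htb.le.trans hb.2⟩,
    ← image_openSegment ℝ (AffineMap.lineMap x y : ℝ →ᵃ[ℝ] ℂ)]
  refine ⟨_, ?_, rfl⟩
  rw [openSegment_eq_Ioo (by gcongr; exact hat.trans htb)]
  exact ⟨by gcongr, by gcongr⟩

/-- The curves of the parts of an edge are the parts of its curve. -/
theorem edgeCurve_edgeCurve {N k : ℕ} (hN : n ≤ N) (hk : k < gridSize l n N) {s : ℝ}
    (hs : s ∈ Set.Icc 0 (edgeLength l N)) :
    edgeCurve hl (prec_edgeCurve hl h hN hk) s = edgeCurve hl h (k * edgeLength l N + s) := by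
  have h0 := grid_mem_Icc hl hN hk.le
  have h1 := grid_succ_mem_Icc hl hN hk
  have hn : (edgeLength l n : ℂ) ≠ 0 := by exact_mod_cast (edgeLength_pos hl n).ne'
  have hN' : (edgeLength l N : ℂ) ≠ 0 := by exact_mod_cast (edgeLength_pos hl N).ne'
  apply Subtype.ext
  rw [edgeCurve_coe hl _ hs, edgeCurve_coe hl h ⟨add_nonneg h0.1 hs.1, by linarith [h1.2, hs.2]⟩,
    edgeCurve_coe hl h h0, edgeCurve_coe hl h h1]
  simp only [AffineMap.lineMap_apply, vsub_eq_sub, vadd_eq_add, Complex.real_smul]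
  push_cast
  field_simp
  ring

/-- The energy controls the discrete energies on the grids on an edge. -/
theorem grid_sum_le_energy {p : ℝ} {u : C(K l, ℝ)} (hu : u ∈ domain l p) {N : ℕ} (hN : n ≤ N) :
    ∑ k ∈ Finset.range (gridSize l n N), |u (edgeCurve hl h ((k + 1) * edgeLength l N)) -
        u (edgeCurve hl h (k * edgeLength l N))| ^ p ≤
      (energy l p u).toReal * edgeLength l N ^ (p - 1) := by
  classical
  have hd := edgeLength_pos hl N
  have hE : discreteEnergy l p N u ≤ energy l p u := le_iSup (fun n => discreteEnergy l p n u) N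
  rw [discreteEnergy_eq hl, ← ENNReal.ofReal_sum_of_nonneg (fun e _ => by positivity)] at hE
  have hE' := (ENNReal.ofReal_le_iff_le_toReal (ne_of_lt hu)).1 hE
  set c : ℕ → K l × K l := fun k =>
    (edgeCurve hl h (k * edgeLength l N), edgeCurve hl h ((k + 1) * edgeLength l N)) with hc
  have hinj : Set.InjOn c (Finset.range (gridSize l n N)) := by
    intro j hj k hk hjk
    have hj' := Finset.mem_range.1 hj
    have hk' := Finset.mem_range.1 hk
    have := injOn_edgeCurve hl h (grid_mem_Icc hl hN hj'.le) (grid_mem_Icc hl hN hk'.le)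
      (congrArg Prod.fst hjk)
    exact_mod_cast mul_right_cancel₀ hd.ne' this
  have hsub : (Finset.range (gridSize l n N)).image c ⊆ edges hl N := by
    intro e he
    obtain ⟨k, hk, rfl⟩ := Finset.mem_image.1 he
    exact (mem_edges hl).2 (prec_edgeCurve hl h hN (Finset.mem_range.1 hk))
  have h1 := (Finset.sum_le_sum_of_subset_of_nonneg (f := fun e : K l × K l =>
    |u e.2 - u e.1| ^ p * edgeLength l N ^ (1 - p)) hsub fun e _ _ => by positivity).trans hE'
  rw [Finset.sum_image hinj, ← Finset.sum_mul] at h1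
  have h2 := mul_le_mul_of_nonneg_right h1 (Real.rpow_pos_of_pos hd (p - 1)).le
  rwa [mul_assoc, ← Real.rpow_add hd, show (1 - p) + (p - 1) = 0 by ring, Real.rpow_zero,
    mul_one] at h2

omit h in
theorem gridSize_shift (n N : ℕ) : gridSize l n (n + N) * edgeLength l (n + N) = edgeLength l n :=
  gridSize_mul hl (Nat.le_add_right n N)

omit h in
theorem edgeLength_shift_tendsto (n : ℕ) :
    Tendsto (fun N => edgeLength l (n + N)) atTop (𝓝 0) := by
  have := (edgeLength_tendsto hl).comp (tendsto_add_atTop_nat n)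
  refine this.congr fun N => ?_
  simp [add_comm]

theorem absolutelyContinuous_edgeCurve {p : ℝ} (hp : 1 < p) {u : C(K l, ℝ)} (hu : u ∈ domain l p) :
    AbsolutelyContinuousOnInterval (fun t => u (edgeCurve hl h t)) 0 (edgeLength l n) :=
  absolutelyContinuous_of_grid (u.continuous.comp (continuous_edgeCurve hl h)) hp
    (fun N => edgeLength_pos hl (n + N)) (edgeLength_shift_tendsto hl n) (gridSize_shift hl n)
    fun N => grid_sum_le_energy hl h hu (Nat.le_add_right n N)

end

/-! ### Slopes and the derivative along edges -/

/-- The gradient of the piecewise affine interpolation of `u` at level `n`. -/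
noncomputable def slope {l : ℕ → ℕ} (hl : ∀ k, Odd (l k) ∧ 3 ≤ l k) (n : ℕ) (u : C(K l, ℝ))
    (z : K l) : ℝ :=
  ∑ e ∈ edges hl n, (edgeSet l e.1 e.2).indicator (fun _ => (u e.2 - u e.1) / edgeLength l n) z

/-- `g` is the derivative of `u` along almost all of every edge. -/
def HasCurveDeriv {l : ℕ → ℕ} (hl : ∀ k, Odd (l k) ∧ 3 ≤ l k) (u : C(K l, ℝ)) (g : K l → ℝ) :
    Prop :=
  ∀ n x y (h : Prec l n x y), ∀ᵐ t ∂(volume.restrict (Set.Icc 0 (edgeLength l n))),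
    HasDerivAt (fun t => u (edgeCurve hl h t)) (g (edgeCurve hl h t)) t

section
variable {l : ℕ → ℕ} (hl : ∀ k, Odd (l k) ∧ 3 ≤ l k)
include hl

theorem measurable_slope (n : ℕ) (u : C(K l, ℝ)) : Measurable (slope hl n u) :=
  Finset.measurable_fun_sum _ fun e _ =>
    measurable_const.indicator (measurableSet_edgeSet l e.1 e.2)

theorem slope_eq {n : ℕ} (u : C(K l, ℝ)) {x y z : K l} (h : Prec l n x y)
    (hz : (z : ℂ) ∈ openSegment ℝ (x : ℂ) (y : ℂ)) :
    slope hl n u z = (u y - u x) / edgeLength l n := by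
  have hmem : (x, y) ∈ edges hl n := (mem_edges hl).2 h
  rw [slope, Finset.sum_eq_single_of_mem _ hmem]
  · rw [Set.indicator_of_mem]
    exact openSegment_subset_segment ℝ _ _ hz
  · intro e he hne
    refine Set.indicator_of_notMem (fun hze => hne ?_) _
    have := h.unique hl ((mem_edges hl).1 he) hz hze
    exact Prod.ext (Subtype.ext this.1.symm) (Subtype.ext this.2.symm)

omit hl in
theorem ae_mem_Ioo (D : ℝ) : ∀ᵐ t ∂(volume.restrict (Set.Icc 0 D)), t ∈ Set.Ioo 0 D := by
  rw [ae_restrict_iff' measurableSet_Icc]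
  filter_upwards [Measure.ae_ne volume 0, Measure.ae_ne volume D] with t h0 h1 ht
  exact ⟨lt_of_le_of_ne ht.1 h0.symm, lt_of_le_of_ne ht.2 h1⟩

omit hl in
theorem ae_not_grid (l : ℕ → ℕ) (D : ℝ) :
    ∀ᵐ t ∂(volume.restrict (Set.Icc 0 D)), ∀ N k : ℕ, t ≠ k * edgeLength l N :=
  ae_restrict_of_ae (ae_all_iff.2 fun _ => ae_all_iff.2 fun _ => Measure.ae_ne volume _)

/-- The slopes converge to the derivative of `u` along an edge. -/
theorem tendsto_slope (u : C(K l, ℝ)) {n : ℕ} {x y : ℂ} (h : Prec l n x y) {t d : ℝ}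
    (ht : t ∈ Set.Ioo 0 (edgeLength l n)) (htg : ∀ N k : ℕ, t ≠ k * edgeLength l N)
    (hd : HasDerivAt (fun t => u (edgeCurve hl h t)) d t) :
    Tendsto (fun N => slope hl N u (edgeCurve hl h t)) atTop (𝓝 d) := by
  have hpos := edgeLength_pos hl
  have hlim := edgeLength_tendsto hl
  have ha := tendsto_floor_mul hpos hlim ht.1.le
  have hb : Tendsto (fun N => ((⌊t / edgeLength l N⌋₊ : ℝ) + 1) * edgeLength l N) atTop (𝓝 t) := by
    have := ha.add hlim
    rw [add_zero] at this
    exact this.congr fun N => by ring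
  have hat : ∀ N, (⌊t / edgeLength l N⌋₊ : ℝ) * edgeLength l N < t := fun N =>
    lt_of_le_of_ne ((le_div_iff₀ (hpos N)).1 (Nat.floor_le (div_nonneg ht.1.le (hpos N).le)))
      (htg N _).symm
  have htb : ∀ N, t < ((⌊t / edgeLength l N⌋₊ : ℝ) + 1) * edgeLength l N := fun N =>
    (div_lt_iff₀ (hpos N)).1 (Nat.lt_floor_add_one _)
  -- Off the grid points, the slope at level `N ≥ n` is the difference quotient over the grid
  -- interval around `t`.
  refine (tendsto_straddle hd (Eventually.of_forall hat) (Eventually.of_forall htb) ha hb).congr' ?_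
  filter_upwards [eventually_ge_atTop n] with N hN
  have hk : ⌊t / edgeLength l N⌋₊ < gridSize l n N := by
    rw [Nat.floor_lt (div_nonneg ht.1.le (hpos N).le), div_lt_iff₀ (hpos N), gridSize_mul hl hN]
    exact ht.2
  rw [slope_eq hl u (prec_edgeCurve hl h hN hk) (edgeCurve_mem_openSegment hl h
    (grid_mem_Icc hl hN hk.le) (grid_succ_mem_Icc hl hN hk) (hat N) (htb N))]
  congr 1
  ring

/-- Two edges of one level share at most end points, and points are null for one-dimensional
Hausdorff measure. -/
theorem aedisjoint_edgeSet (n : ℕ) :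
    Set.Pairwise (edges hl n : Set (K l × K l))
      (Function.onFun (AEDisjoint (ν l)) fun e => edgeSet l e.1 e.2) := by
  have := Measure.nullSingletonClass_hausdorff (K l) (d := 1) one_pos
  intro e he e' he' hne
  have h := (mem_edges hl).1 he
  have h' := (mem_edges hl).1 he'
  have hsub : edgeSet l e.1 e.2 ∩ edgeSet l e'.1 e'.2 ⊆ {e.1, e.2} := by
    rintro z ⟨hz, hz'⟩
    by_contra hcon
    have hz1 : (z : ℂ) ≠ e.1 := fun hc => hcon (Or.inl (Subtype.ext hc))
    have hz2 : (z : ℂ) ≠ e.2 := fun hc => hcon (Or.inr (Subtype.ext hc))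
    have := h.unique hl h' (mem_openSegment_of_ne_left_right hz1.symm hz2.symm hz) hz'
    exact hne (Prod.ext (Subtype.ext this.1) (Subtype.ext this.2))
  refine measure_mono_null hsub (Measure.absolutelyContinuous_of_le Measure.restrict_le_self ?_)
  exact (Set.toFinite _).measure_zero _

theorem lintegral_biUnion_edgeSet (n : ℕ) (f : K l → ℝ≥0∞) :
    ∫⁻ z in ⋃ e ∈ edges hl n, edgeSet l e.1 e.2, f z ∂(ν l) =
      ∑ e ∈ edges hl n, ∫⁻ z in edgeSet l e.1 e.2, f z ∂(ν l) :=
  lintegral_biUnion_finset₀ (aedisjoint_edgeSet hl n)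
    (fun e _ => (measurableSet_edgeSet l e.1 e.2).nullMeasurableSet) f

theorem lintegral_slope_le {p : ℝ} (hp : 1 < p) (n : ℕ) (u : C(K l, ℝ)) :
    ∫⁻ z, ENNReal.ofReal (|slope hl n u z| ^ p) ∂(ν l) ≤ discreteEnergy l p n u := by
  have hpos := edgeLength_pos hl n
  have hmeas : Measurable fun z => ENNReal.ofReal (|slope hl n u z| ^ p) :=
    (((measurable_slope hl n u).abs).pow_const p).ennreal_ofReal
  have hsub : Function.support (fun z => ENNReal.ofReal (|slope hl n u z| ^ p)) ⊆
      ⋃ e ∈ edges hl n, edgeSet l e.1 e.2 := by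
    intro z hz
    by_contra hcon
    simp only [Set.mem_iUnion, not_exists] at hcon
    refine hz ?_
    have : slope hl n u z = 0 := Finset.sum_eq_zero fun e he =>
      Set.indicator_of_notMem (hcon e he) _
    simp [this, Real.zero_rpow (by linarith : p ≠ 0)]
  rw [← setLIntegral_eq_of_support_subset hsub, discreteEnergy_eq hl,
    lintegral_biUnion_edgeSet hl]
  refine Finset.sum_le_sum fun e he => ?_
  have h := (mem_edges hl).1 he
  rw [lintegral_edgeSet hl h hmeas.aemeasurable]
  have hae : ∀ᵐ t ∂(volume.restrict (Set.Icc 0 (edgeLength l n))),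
      ENNReal.ofReal (|slope hl n u (edgeCurve hl h t)| ^ p) =
        ENNReal.ofReal (|(u e.2 - u e.1) / edgeLength l n| ^ p) := by
    filter_upwards [ae_mem_Ioo (edgeLength l n)] with t ht
    have hm := edgeCurve_mem_openSegment hl h ⟨le_rfl, hpos.le⟩ ⟨hpos.le, le_rfl⟩ ht.1 ht.2
    rw [edgeCurve_zero hl h, edgeCurve_edgeLength hl h] at hm
    rw [slope_eq hl u h hm]
  rw [lintegral_congr_ae hae, setLIntegral_const, Real.volume_Icc, sub_zero,
    ← ENNReal.ofReal_mul (by positivity), abs_div, abs_of_pos hpos,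
    Real.div_rpow (abs_nonneg _) hpos.le, Real.rpow_sub hpos, Real.rpow_one]
  refine ENNReal.ofReal_le_ofReal (le_of_eq ?_)
  ring

theorem hasCurveDeriv_of_tendsto {p : ℝ} (hp : 1 < p) {u : C(K l, ℝ)} (hu : u ∈ domain l p)
    {g : K l → ℝ} (hg : ∀ᵐ z ∂(ν l), Tendsto (fun N => slope hl N u z) atTop (𝓝 (g z))) :
    HasCurveDeriv hl u g := by
  intro n x y h
  have hac := absolutelyContinuous_edgeCurve hl h hp hu
  filter_upwards [ae_edgeCurve hl h hg, ae_mem_Ioo (edgeLength l n), ae_not_grid l (edgeLength l n),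
    ae_restrict_of_ae hac.ae_differentiableAt] with t h1 h2 h3 h4
  have hd := (h4 (by rw [Set.uIcc_of_le (edgeLength_pos hl n).le]
                     exact Set.Ioo_subset_Icc_self h2)).hasDerivAt
  rwa [tendsto_nhds_unique h1 (tendsto_slope hl u h h2 h3 hd)]

theorem ae_tendsto_slope {u : C(K l, ℝ)} {g : K l → ℝ} (hg : HasCurveDeriv hl u g) :
    ∀ᵐ z ∂(ν l), Tendsto (fun N => slope hl N u z) atTop (𝓝 (g z)) := by
  refine ae_of_edgeCurve hl fun n x y h => ?_
  filter_upwards [ae_mem_Ioo (edgeLength l n), ae_not_grid l (edgeLength l n), hg n x y h]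
    with t h2 h3 h4 using tendsto_slope hl u h h2 h3 h4

/-- The limit of the slopes is defined on `K` itself, so it serves all edges of all levels at once
and nothing has to be glued. -/
theorem exists_hasCurveDeriv {p : ℝ} (hp : 1 < p) {u : C(K l, ℝ)} (hu : u ∈ domain l p) :
    ∃ g, Measurable g ∧ HasCurveDeriv hl u g := by
  have h1 : ∀ᵐ z ∂(ν l), ∃ d, Tendsto (fun N => slope hl N u z) atTop (𝓝 d) := by
    refine ae_of_edgeCurve hl fun n x y h => ?_
    have hac := absolutelyContinuous_edgeCurve hl h hp hu
    filter_upwards [ae_mem_Ioo (edgeLength l n), ae_not_grid l (edgeLength l n),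
      ae_restrict_of_ae hac.ae_differentiableAt] with t h2 h3 h4
    have hd := (h4 (by rw [Set.uIcc_of_le (edgeLength_pos hl n).le]
                       exact Set.Ioo_subset_Icc_self h2)).hasDerivAt
    exact ⟨_, tendsto_slope hl u h h2 h3 hd⟩
  obtain ⟨g, hg, hlim⟩ := measurable_limit_of_tendsto_metrizable_ae
    (fun N => (measurable_slope hl N u).aemeasurable) h1
  exact ⟨g, hg, hasCurveDeriv_of_tendsto hl hp hu hlim⟩

/-- Fatou's lemma for the slopes, whose `p`-th powers have integral at most the discrete energy. -/
theorem lintegral_le_energy {p : ℝ} (hp : 1 < p) {u : C(K l, ℝ)} {g : K l → ℝ}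
    (hg : HasCurveDeriv hl u g) :
    ∫⁻ z, ENNReal.ofReal (|g z| ^ p) ∂(ν l) ≤ energy l p u := by
  have hlim := ae_tendsto_slope hl hg
  have hmeas : ∀ N, Measurable fun z => ENNReal.ofReal (|slope hl N u z| ^ p) := fun N =>
    (((measurable_slope hl N u).abs).pow_const p).ennreal_ofReal
  calc ∫⁻ z, ENNReal.ofReal (|g z| ^ p) ∂(ν l)
      = ∫⁻ z, liminf (fun N => ENNReal.ofReal (|slope hl N u z| ^ p)) atTop ∂(ν l) := by
        refine lintegral_congr_ae ?_
        filter_upwards [hlim] with z hz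
        exact ((ENNReal.tendsto_ofReal
          (hz.abs.rpow_const (p := p) (Or.inr (by linarith)))).liminf_eq).symm
    _ ≤ liminf (fun N => ∫⁻ z, ENNReal.ofReal (|slope hl N u z| ^ p) ∂(ν l)) atTop :=
        lintegral_liminf_le hmeas
    _ ≤ energy l p u := by
        refine liminf_le_of_le (by isBoundedDefault) fun b hb => ?_
        obtain ⟨N, hN⟩ := hb.exists
        exact hN.trans ((lintegral_slope_le hl hp N u).trans
          (le_iSup (fun n => discreteEnergy l p n u) N))

/-! ### Gradients: existence, uniqueness and the energy identity -/

omit hl in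
theorem eLpNorm_lt_top_iff {p : ℝ} (hp : 1 < p) {α : Type*} [MeasurableSpace α] {μ : Measure α}
    {g : α → ℝ} :
    eLpNorm g (ENNReal.ofReal p) μ < ∞ ↔ ∫⁻ z, ENNReal.ofReal (|g z| ^ p) ∂μ < ∞ := by
  have hp0 : 0 < p := by linarith
  rw [eLpNorm_lt_top_iff_lintegral_rpow_enorm_lt_top (by simpa using hp0) ENNReal.ofReal_ne_top,
    ENNReal.toReal_ofReal hp0.le]
  have : ∀ z, ‖g z‖ₑ ^ p = ENNReal.ofReal (|g z| ^ p) := fun z => by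
    rw [Real.enorm_eq_ofReal_abs, ENNReal.ofReal_rpow_of_nonneg (abs_nonneg _) hp0.le]
  simp only [this]

theorem HasCurveDeriv.isGradient {p : ℝ} (hp : 1 < p) {u : C(K l, ℝ)} (hu : u ∈ domain l p)
    {g : K l → ℝ} (hg : AEStronglyMeasurable g (ν l)) (hd : HasCurveDeriv hl u g) :
    IsGradient l p u g := by
  refine ⟨⟨hg, (eLpNorm_lt_top_iff hp).2 ((lintegral_le_energy hl hp hd).trans_lt hu)⟩, ?_⟩
  intro n x y h
  have hpos := edgeLength_pos hl n
  have hac := absolutelyContinuous_edgeCurve hl h hp hu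
  change _ = ∫ z in edgeSet l x y, g z ∂(ν l)
  have h0 : edgeCurve hl h 0 = x := Subtype.ext (edgeCurve_zero hl h)
  have h1 : edgeCurve hl h (edgeLength l n) = y := Subtype.ext (edgeCurve_edgeLength hl h)
  rw [setIntegral_edgeSet hl h hg]
  have := hac.integral_deriv_eq_sub
  rw [h0, h1] at this
  rw [← this]
  refine intervalIntegral.integral_congr_ae_restrict ?_
  rw [Set.uIoc_of_le hpos.le]
  refine ae_restrict_of_ae_restrict_of_subset Set.Ioc_subset_Icc_self ?_
  filter_upwards [hd n x y h] with t ht using ht.deriv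

theorem exists_isGradient {p : ℝ} (hp : 1 < p) {u : C(K l, ℝ)} (hu : u ∈ domain l p) :
    ∃ g, IsGradient l p u g ∧ HasCurveDeriv hl u g := by
  obtain ⟨g, hg, hd⟩ := exists_hasCurveDeriv hl hp hu
  exact ⟨g, hd.isGradient hl hp hu hg.aestronglyMeasurable, hd⟩

theorem integrableOn_edgeSet {p : ℝ} (hp : 1 < p) {g : K l → ℝ}
    (hg : MemLp g (ENNReal.ofReal p) (ν l)) {n : ℕ} {x y : ℂ} (h : Prec l n x y) :
    IntegrableOn g (edgeSet l x y) (ν l) := by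
  have : IsFiniteMeasure ((ν l).restrict (edgeSet l x y)) :=
    ⟨by rw [Measure.restrict_apply_univ, nu_edgeSet hl h]; exact ENNReal.ofReal_lt_top⟩
  exact (hg.restrict _).integrable (by simpa using hp.le)

theorem intervalIntegrable_edgeCurve {p : ℝ} (hp : 1 < p) {g : K l → ℝ}
    (hg : MemLp g (ENNReal.ofReal p) (ν l)) {n : ℕ} {x y : ℂ} (h : Prec l n x y) :
    IntervalIntegrable (fun t => g (edgeCurve hl h t)) volume 0 (edgeLength l n) := by
  have h1 := integrableOn_edgeSet hl hp hg h
  rw [IntegrableOn, restrict_edgeSet hl h] at h1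
  rw [intervalIntegrable_iff_integrableOn_Icc_of_le (edgeLength_pos hl n).le]
  exact (integrable_map_measure h1.aestronglyMeasurable
    (continuous_edgeCurve hl h).aemeasurable).1 h1

/-- On every grid piece of an edge both functions integrate to the same increment of `u`. -/
theorem IsGradient.ae_eq {p : ℝ} (hp : 1 < p) {u : C(K l, ℝ)} {g g' : K l → ℝ}
    (hg : IsGradient l p u g) (hg' : IsGradient l p u g') : g =ᵐ[ν l] g' := by
  refine ae_of_edgeCurve hl fun n x y h => ?_
  have hi := intervalIntegrable_edgeCurve hl hp hg.1 h
  have hi' := intervalIntegrable_edgeCurve hl hp hg'.1 h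
  have hgrid : ∀ f, IsGradient l p u f → ∀ N, ∀ k < gridSize l n (n + N),
      ∫ t in (k * edgeLength l (n + N))..((k + 1) * edgeLength l (n + N)), f (edgeCurve hl h t) =
        u (edgeCurve hl h ((k + 1) * edgeLength l (n + N))) -
          u (edgeCurve hl h (k * edgeLength l (n + N))) := by
    intro f hf N k hk
    have hsub := prec_edgeCurve hl h (Nat.le_add_right n N) hk
    rw [hf.2 _ _ _ hsub]
    refine Eq.trans ?_ (setIntegral_edgeSet hl hsub hf.1.1).symm
    have hshift := intervalIntegral.integral_comp_add_left (a := 0) (b := edgeLength l (n + N))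
      (fun t => f (edgeCurve hl h t)) (k * edgeLength l (n + N))
    rw [add_zero, ← add_one_mul] at hshift
    rw [← hshift]
    refine intervalIntegral.integral_congr fun s hs => ?_
    rw [Set.uIcc_of_le (edgeLength_pos hl _).le] at hs
    rw [edgeCurve_edgeCurve hl h (Nat.le_add_right n N) hk hs]
  have hz := ae_eq_zero_of_grid (h := fun t => g (edgeCurve hl h t) - g' (edgeCurve hl h t))
    (fun N => edgeLength_pos hl (n + N)) (edgeLength_shift_tendsto hl n) (gridSize_shift hl n)
    (hi.sub hi') fun N k hk => by
      have hmono : Set.uIcc (k * edgeLength l (n + N)) ((k + 1) * edgeLength l (n + N)) ⊆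
          Set.uIcc 0 (edgeLength l n) := by
        rw [Set.uIcc_of_le (edgeLength_pos hl n).le]
        exact Set.uIcc_subset_Icc (grid_mem_Icc hl (Nat.le_add_right n N) hk.le)
          (grid_succ_mem_Icc hl (Nat.le_add_right n N) hk)
      rw [intervalIntegral.integral_sub (hi.mono_set hmono) (hi'.mono_set hmono),
        hgrid g hg N k hk, hgrid g' hg' N k hk, sub_self]
  filter_upwards [hz] with t ht using sub_eq_zero.1 ht

-- Jensen's inequality on a set of mass `D`, obtained by comparing the `L^1` and `L^p` norms.
omit hl in
theorem rpow_integral_le {p : ℝ} (hp : 1 < p) {α : Type*} [MeasurableSpace α] {μ : Measure α}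
    {D : ℝ} (hD : 0 < D) (hμ : μ Set.univ = ENNReal.ofReal D) {g : α → ℝ}
    (hg : AEStronglyMeasurable g μ) :
    ENNReal.ofReal (|∫ z, g z ∂μ| ^ p * D ^ (1 - p)) ≤ ∫⁻ z, ENNReal.ofReal (|g z| ^ p) ∂μ := by
  have hp0 : 0 < p := by linarith
  have hnorm : ∀ z, ‖g z‖ₑ ^ p = ENNReal.ofReal (|g z| ^ p) := fun z => by
    rw [Real.enorm_eq_ofReal_abs, ENNReal.ofReal_rpow_of_nonneg (abs_nonneg _) hp0.le]
  have h1 : ENNReal.ofReal |∫ z, g z ∂μ| ≤ eLpNorm g 1 μ := by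
    rw [eLpNorm_one_eq_lintegral_enorm, ← Real.enorm_eq_ofReal_abs]
    exact enorm_integral_le_lintegral_enorm g
  have h2 := eLpNorm_le_eLpNorm_mul_rpow_measure_univ (μ := μ) (p := 1) (q := ENNReal.ofReal p)
    (by simpa using hp.le) hg
  rw [ENNReal.toReal_one, ENNReal.toReal_ofReal hp0.le, hμ] at h2
  have h3 := ENNReal.rpow_le_rpow (h1.trans h2) hp0.le
  rw [ENNReal.mul_rpow_of_nonneg _ _ hp0.le, eLpNorm_eq_lintegral_rpow_enorm_toReal (by simpa using hp0)
    ENNReal.ofReal_ne_top, ENNReal.toReal_ofReal hp0.le, ← ENNReal.rpow_mul, ← ENNReal.rpow_mul,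
    one_div_mul_cancel hp0.ne', ENNReal.rpow_one,
    ENNReal.ofReal_rpow_of_nonneg (abs_nonneg _) hp0.le,
    show (1 / 1 - 1 / p) * p = p - 1 by field_simp, ENNReal.ofReal_rpow_of_pos hD] at h3
  simp only [hnorm] at h3
  rw [ENNReal.ofReal_mul (by positivity)]
  refine (mul_le_mul_left h3 _).trans ?_
  rw [mul_assoc, ← ENNReal.ofReal_mul (by positivity), ← Real.rpow_add hD,
    show p - 1 + (1 - p) = 0 by ring, Real.rpow_zero, ENNReal.ofReal_one, mul_one]

theorem IsGradient.discreteEnergy_le {p : ℝ} (hp : 1 < p) {u : C(K l, ℝ)} {g : K l → ℝ}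
    (hg : IsGradient l p u g) (n : ℕ) :
    discreteEnergy l p n u ≤ ∫⁻ z, ENNReal.ofReal (|g z| ^ p) ∂(ν l) := by
  calc discreteEnergy l p n u
      ≤ ∑ e ∈ edges hl n, ∫⁻ z in edgeSet l e.1 e.2, ENNReal.ofReal (|g z| ^ p) ∂(ν l) := by
        rw [discreteEnergy_eq hl]
        refine Finset.sum_le_sum fun e he => ?_
        have h := (mem_edges hl).1 he
        rw [hg.2 n e.1 e.2 h]
        exact rpow_integral_le hp (edgeLength_pos hl n)
          (by rw [Measure.restrict_apply_univ]; exact nu_edgeSet hl h) hg.1.1.restrict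
    _ = ∫⁻ z in ⋃ e ∈ edges hl n, edgeSet l e.1 e.2, ENNReal.ofReal (|g z| ^ p) ∂(ν l) :=
        (lintegral_biUnion_edgeSet hl n _).symm
    _ ≤ _ := setLIntegral_le_lintegral _ _

/-- A gradient in `L^p` already forces finite energy; this is what puts sums into the domain. -/
theorem IsGradient.mem_domain {p : ℝ} (hp : 1 < p) {u : C(K l, ℝ)} {g : K l → ℝ}
    (hg : IsGradient l p u g) : u ∈ domain l p :=
  (iSup_le fun n => hg.discreteEnergy_le hl hp n).trans_lt ((eLpNorm_lt_top_iff hp).1 hg.1.2)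

/-- By uniqueness, any gradient agrees a.e. with the one constructed as a derivative along the
edges. -/
theorem IsGradient.hasCurveDeriv {p : ℝ} (hp : 1 < p) {u : C(K l, ℝ)} {g : K l → ℝ}
    (hg : IsGradient l p u g) : HasCurveDeriv hl u g := by
  obtain ⟨g', hg', hd⟩ := exists_isGradient hl hp (hg.mem_domain hl hp)
  intro n x y h
  filter_upwards [hd n x y h, ae_edgeCurve hl h (hg.ae_eq hl hp hg')] with t h1 h2
  rwa [h2]

theorem IsGradient.lintegral_eq {p : ℝ} (hp : 1 < p) {u : C(K l, ℝ)} {g : K l → ℝ}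
    (hg : IsGradient l p u g) :
    ∫⁻ z, ENNReal.ofReal (|g z| ^ p) ∂(ν l) = energy l p u :=
  le_antisymm (lintegral_le_energy hl hp (hg.hasCurveDeriv hl hp))
    (iSup_le fun n => hg.discreteEnergy_le hl hp n)

end

/-! ### Constants, sums, compositions and compact null sets -/

section
variable {l : ℕ → ℕ} (hl : ∀ k, Odd (l k) ∧ 3 ≤ l k)
include hl

omit hl in
theorem isCompact_K0 : IsCompact K0 := by
  refine Set.Finite.isCompact_convexHull (𝕜 := ℝ) (s := {z | ∃ j : ℕ, 1 ≤ j ∧ j ≤ 4 ∧ z = q j}) ?_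
  refine ((Set.finite_Iic 4).image q).subset ?_
  rintro z ⟨j, -, hj, rfl⟩
  exact ⟨j, hj, rfl⟩

theorem isCompact_cells (n : ℕ) : IsCompact (cells l n) := by
  have : cells l n = ⋃ c ∈ {c | Center l n c},
      (fun z => point l n c + (edgeLength l n : ℂ) * z) '' K0 := by
    ext z
    simp only [mem_cells_iff, Set.mem_iUnion, Set.mem_image, Set.mem_ofPred_eq, exists_prop]
    constructor
    · rintro ⟨w, hw, a, ha, rfl⟩
      obtain ⟨c, hc, hwc⟩ := exists_center_of_mem_words hl hw
      exact ⟨c, hc, a, ha, by rw [wordMap_eq, hwc]⟩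
    · rintro ⟨c, hc, a, ha, rfl⟩
      obtain ⟨w, hw, hwc⟩ := hc.exists_word hl
      exact ⟨w, hw, a, ha, by rw [wordMap_eq, hwc]⟩
  rw [this]
  exact (finite_center l n).isCompact_biUnion fun c _ => isCompact_K0.image (by fun_prop)

theorem compactSpace_K : CompactSpace (K l) := by
  rw [← isCompact_iff_compactSpace]
  refine (isCompact_cells hl 1).of_isClosed_subset ?_ fun z hz => mem_K_iff.1 hz 1 le_rfl
  have : K l = ⋂ (n : ℕ) (_ : 1 ≤ n), cells l n := rfl
  rw [this]
  exact isClosed_biInter fun n _ => (isCompact_cells hl n).isClosed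

/-- Each graph is connected and contains `0`, so `u` equals its value at `0` on all vertices, and
these are dense in `K`. -/
theorem eq_const_of_energy_eq_zero {p : ℝ} {u : C(K l, ℝ)} (hu : energy l p u = 0) :
    ∃ c : ℝ, ∀ x, u x = c := by
  have hedge : ∀ n (x y : K l), Prec l n x y → u x = u y := by
    intro n x y h
    have hpos := edgeLength_pos hl n
    have h0 : discreteEnergy l p n u = 0 :=
      le_antisymm ((le_iSup (fun n => discreteEnergy l p n u) n).trans hu.le) zero_le
    rw [discreteEnergy_eq hl, Finset.sum_eq_zero_iff] at h0
    have h1 := ENNReal.ofReal_eq_zero.1 (h0 (x, y) ((mem_edges hl).2 h))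
    by_contra hne
    have h2 : 0 < |u y - u x| := abs_pos.2 (sub_ne_zero.2 (Ne.symm hne))
    exact absurd h1 (not_le.2 (by positivity))
  have h0K : (0 : ℂ) ∈ K l := by
    have := V_subset hl 0 ((center_zero l hl 0).point_mem hl)
    rwa [point_zero] at this
  refine ⟨u ⟨0, h0K⟩, fun z => ?_⟩
  choose v hv hvd using fun n : ℕ => exists_mem_V_dist_le hl z.2 (n := n + 1) (by omega)
  have hlim : Tendsto (fun n => (⟨v n, V_subset hl _ (hv n)⟩ : K l)) atTop (𝓝 z) := by
    rw [tendsto_iff_dist_tendsto_zero]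
    refine squeeze_zero (fun _ => dist_nonneg) (fun n => ?_)
      ((edgeLength_tendsto hl).comp (tendsto_add_atTop_nat 1))
    rw [dist_comm]
    exact hvd n
  have h1 := (u.continuous.tendsto z).comp hlim
  refine tendsto_nhds_unique h1 (tendsto_const_nhds.congr fun n => ?_)
  exact eq_of_reachable hl (hedge (n + 1)) (reachable hl (hv n)) h0K _

theorem energy_eq_zero_of_const {p : ℝ} (hp : 1 < p) {u : C(K l, ℝ)} {c : ℝ}
    (hu : ∀ x, u x = c) : energy l p u = 0 := by
  refine le_antisymm (iSup_le fun n => ?_) zero_le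
  rw [discreteEnergy_eq hl]
  simp [hu, Real.zero_rpow (by linarith : p ≠ 0)]

theorem IsGradient.add {p : ℝ} (hp : 1 < p) {u₁ u₂ : C(K l, ℝ)} {g₁ g₂ : K l → ℝ}
    (h₁ : IsGradient l p u₁ g₁) (h₂ : IsGradient l p u₂ g₂) :
    IsGradient l p (u₁ + u₂) (g₁ + g₂) := by
  refine ⟨h₁.1.add h₂.1, fun n x y h => ?_⟩
  have := integral_add (integrableOn_edgeSet hl hp h₁.1 h) (integrableOn_edgeSet hl hp h₂.1 h)
  refine Eq.trans ?_ this.symm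
  have e₁ := h₁.2 n x y h
  have e₂ := h₂.2 n x y h
  simp only [ContinuousMap.add_apply]
  change _ = ∫ z in edgeSet l x y, g₁ z ∂(ν l) at e₁
  change _ = ∫ z in edgeSet l x y, g₂ z ∂(ν l) at e₂
  linarith

/-- As `K` is compact, `u` takes values in a ball on which `f` is Lipschitz, so each discrete energy
grows at most by the factor `C ^ p`. -/
theorem comp_mem_domain {p : ℝ} (hp : 1 < p) {f : ℝ → ℝ} (hf : ContDiff ℝ 1 f) {u : C(K l, ℝ)}
    (hu : u ∈ domain l p) : (⟨f, hf.continuous⟩ : C(ℝ, ℝ)).comp u ∈ domain l p := by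
  have := compactSpace_K hl
  obtain ⟨R, hR⟩ := (isCompact_range u.continuous).isBounded.subset_closedBall 0
  obtain ⟨C, hC⟩ := hf.contDiffOn.exists_lipschitzOnWith one_ne_zero
    (convex_closedBall (0 : ℝ) R) (isCompact_closedBall 0 R)
  have hle : ∀ n, discreteEnergy l p n ((⟨f, hf.continuous⟩ : C(ℝ, ℝ)).comp u) ≤
      ENNReal.ofReal ((C : ℝ) ^ p) * discreteEnergy l p n u := by
    intro n
    have hpos := edgeLength_pos hl n
    rw [discreteEnergy_eq hl, discreteEnergy_eq hl, Finset.mul_sum]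
    refine Finset.sum_le_sum fun e _ => ?_
    rw [← ENNReal.ofReal_mul (by positivity), ← mul_assoc,
      ← Real.mul_rpow (by positivity) (abs_nonneg _)]
    refine ENNReal.ofReal_le_ofReal ?_
    gcongr
    have := hC.dist_le_mul (u e.2) (hR ⟨e.2, rfl⟩) (u e.1) (hR ⟨e.1, rfl⟩)
    simpa [Real.dist_eq] using this
  have hu' : energy l p u < ∞ := hu
  refine lt_of_le_of_lt (iSup_le fun n => (hle n).trans ?_)
    (ENNReal.mul_lt_top (ENNReal.ofReal_lt_top (r := (C : ℝ) ^ p)) hu')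
  gcongr
  exact le_iSup (fun n => discreteEnergy l p n u) n

theorem IsGradient.comp {p : ℝ} (hp : 1 < p) {f : ℝ → ℝ} (hf : ContDiff ℝ 1 f) {u : C(K l, ℝ)}
    {g : K l → ℝ} (hg : IsGradient l p u g) :
    IsGradient l p ((⟨f, hf.continuous⟩ : C(ℝ, ℝ)).comp u) (fun z => deriv f (u z) * g z) := by
  have hcont : Continuous fun z => deriv f (u z) :=
    (hf.continuous_deriv le_rfl).comp u.continuous
  refine HasCurveDeriv.isGradient hl hp (comp_mem_domain hl hp hf (hg.mem_domain hl hp))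
    (hcont.aestronglyMeasurable.mul hg.1.1) fun n x y h => ?_
  filter_upwards [hg.hasCurveDeriv hl hp n x y h] with t ht
  exact ((hf.differentiable one_ne_zero _).hasDerivAt).comp t ht

/-- The gradient of `u` vanishes almost everywhere on the preimage of a compact null set. -/
theorem IsGradient.ae_eq_zero_of_isCompact {p : ℝ} (hp : 1 < p) {u : C(K l, ℝ)} {g : K l → ℝ}
    (hg : IsGradient l p u g) {A : Set ℝ} (hA : IsCompact A) (hA0 : volume A = 0) :
    ∀ᵐ z ∂(ν l), u z ∈ A → g z = 0 := by
  have hδ : ∀ k : ℕ, (0 : ℝ) < 1 / (k + 1) := fun k => by positivity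
  -- Continuous functions with values in `[0, 1]` that tend pointwise to the indicator of the closed
  -- set `A`.
  set φ : ℕ → ℝ → ℝ := fun k x => (thickenedIndicator (hδ k) A x : ℝ) with hφ
  have hφc : ∀ k, Continuous (φ k) := fun k =>
    NNReal.continuous_coe.comp (thickenedIndicator (hδ k) A).continuous
  have hφ0 : ∀ k x, 0 ≤ φ k x := fun k x => NNReal.coe_nonneg _
  have hφ1 : ∀ k x, φ k x ≤ 1 := fun k x => by
    have := thickenedIndicator_le_one (hδ k) A x
    exact NNReal.coe_le_one.2 this
  have hφlim : ∀ x, Tendsto (fun k => φ k x) atTop (𝓝 (A.indicator 1 x)) := by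
    intro x
    have h1 := tendsto_pi_nhds.1 (thickenedIndicator_tendsto_indicator_closure hδ
      tendsto_one_div_add_atTop_nhds_zero_nat A) x
    rw [hA.isClosed.closure_eq] at h1
    have h2 := (NNReal.continuous_coe.tendsto _).comp h1
    have h3 : ((A.indicator (fun _ => (1 : NNReal)) x : NNReal) : ℝ) = A.indicator 1 x := by
      by_cases hx : x ∈ A <;> simp [hx]
    rw [h3] at h2
    exact h2
  set F : ℕ → ℝ → ℝ := fun k x => ∫ t in 0..x, φ k t with hF
  have hFd : ∀ k x, HasDerivAt (F k) (φ k x) x := fun k x =>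
    intervalIntegral.integral_hasDerivAt_right ((hφc k).intervalIntegrable _ _)
      ((hφc k).stronglyMeasurableAtFilter _ _) (hφc k).continuousAt
  have hFderiv : ∀ k, deriv (F k) = φ k := fun k => funext fun x => (hFd k x).deriv
  have hFC : ∀ k, ContDiff ℝ 1 (F k) := fun k => by
    rw [contDiff_one_iff_deriv, hFderiv k]
    exact ⟨fun x => (hFd k x).differentiableAt, hφc k⟩
  -- The limit is an integral of the indicator of `A`, which is zero because `A` is null.
  have hFlim : ∀ x, Tendsto (fun k => F k x) atTop (𝓝 0) := by
    intro x
    have h1 := intervalIntegral.tendsto_integral_filter_of_dominated_convergence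
      (μ := volume) (a := 0) (b := x) (F := φ) (f := A.indicator 1) (l := atTop) (fun _ => (1 : ℝ))
      (Eventually.of_forall fun k => (hφc k).aestronglyMeasurable)
      (Eventually.of_forall fun k => Eventually.of_forall fun t _ => by
        rw [Real.norm_of_nonneg (hφ0 k t)]; exact hφ1 k t)
      intervalIntegrable_const (Eventually.of_forall fun t _ => hφlim t)
    have h2 : ∫ t in 0..x, A.indicator (1 : ℝ → ℝ) t = 0 := by
      refine intervalIntegral.integral_zero_ae ?_
      have : ∀ᵐ t : ℝ, t ∉ A := measure_eq_zero_iff_ae_notMem.1 hA0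
      filter_upwards [this] with t ht _ using Set.indicator_of_notMem ht _
    rwa [h2] at h1
  have hAm : Measurable fun z => A.indicator (1 : ℝ → ℝ) (u z) :=
    (measurable_one.indicator hA.measurableSet).comp u.continuous.measurable
  -- On each edge the gradient identity for `F k ∘ u` passes to the limit by dominated convergence:
  -- the increments tend to `0`, the integrands to this product. Uniqueness of the gradient of `0`
  -- then makes the product vanish a.e.
  have hzero : IsGradient l p 0 fun z => A.indicator 1 (u z) * g z := by
    refine ⟨hg.1.mono (hAm.aestronglyMeasurable.mul hg.1.1) (Eventually.of_forall fun z => ?_),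
      fun n x y h => ?_⟩
    · by_cases hz : u z ∈ A <;> simp [hz]
    · change _ = ∫ z in edgeSet l x y, A.indicator 1 (u z) * g z ∂(ν l)
      have h1 : Tendsto (fun k => ∫ z in edgeSet l x y, φ k (u z) * g z ∂(ν l)) atTop
          (𝓝 (∫ z in edgeSet l x y, A.indicator 1 (u z) * g z ∂(ν l))) := by
        refine tendsto_integral_of_dominated_convergence (fun z => ‖g z‖)
          (fun k => ((hφc k).comp u.continuous).aestronglyMeasurable.mul hg.1.1.restrict)
          (integrableOn_edgeSet hl hp hg.1 h).norm
          (fun k => Eventually.of_forall fun z => ?_)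
          (Eventually.of_forall fun z => (hφlim (u z)).mul_const _)
        rw [norm_mul, Real.norm_of_nonneg (hφ0 k _)]
        exact mul_le_of_le_one_left (norm_nonneg _) (hφ1 k _)
      have h2 : ∀ k, ∫ z in edgeSet l x y, φ k (u z) * g z ∂(ν l) = F k (u y) - F k (u x) := by
        intro k
        have := (hg.comp hl hp (hFC k)).2 n x y h
        rw [hFderiv k] at this
        exact this.symm
      simp only [h2] at h1
      have h3 := (hFlim (u y)).sub (hFlim (u x))
      simpa using tendsto_nhds_unique h3 h1
  have h00 : IsGradient l p 0 (0 : K l → ℝ) := ⟨MemLp.zero, fun n x y _ => by simp⟩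
  filter_upwards [hzero.ae_eq hl hp h00] with z hz hmem
  simpa [hmem] using hz

end

/-! ### The energy measures -/

/-- The gradient `∂u` of a function `u` of finite `p`-energy. -/
noncomputable def gradient (l : ℕ → ℕ) (p : ℝ) (u : C(K l, ℝ)) : K l → ℝ :=
  open Classical in if h : ∃ g, IsGradient l p u g then h.choose else 0

/-- The `p`-energy measure `|∂u|^p dν`. -/
noncomputable def energyMeasure (l : ℕ → ℕ) (p : ℝ) (u : C(K l, ℝ)) : Measure (K l) :=
  (ν l).withDensity fun z => ENNReal.ofReal (|gradient l p u z| ^ p)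

section
variable {l : ℕ → ℕ} (hl : ∀ k, Odd (l k) ∧ 3 ≤ l k)
include hl

theorem isGradient_gradient {p : ℝ} (hp : 1 < p) {u : C(K l, ℝ)} (hu : u ∈ domain l p) :
    IsGradient l p u (gradient l p u) := by
  obtain ⟨g, hg, -⟩ := exists_isGradient hl hp hu
  have h : ∃ g, IsGradient l p u g := ⟨g, hg⟩
  rw [gradient, dif_pos h]
  exact h.choose_spec

theorem IsGradient.energyMeasure_eq {p : ℝ} (hp : 1 < p) {u : C(K l, ℝ)} {g : K l → ℝ}
    (hg : IsGradient l p u g) :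
    energyMeasure l p u = (ν l).withDensity fun z => ENNReal.ofReal (|g z| ^ p) := by
  refine withDensity_congr_ae ?_
  filter_upwards [(isGradient_gradient hl hp (hg.mem_domain hl hp)).ae_eq hl hp hg] with z hz
  rw [hz]

theorem energyMeasure_univ {p : ℝ} (hp : 1 < p) {u : C(K l, ℝ)} (hu : u ∈ domain l p) :
    energyMeasure l p u Set.univ = energy l p u := by
  rw [energyMeasure, withDensity_apply _ MeasurableSet.univ, Measure.restrict_univ]
  exact (isGradient_gradient hl hp hu).lintegral_eq hl hp

omit hl in
theorem IsGradient.aemeasurable_density {p : ℝ} {u : C(K l, ℝ)} {g : K l → ℝ}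
    (hg : IsGradient l p u g) : AEMeasurable (fun z => ENNReal.ofReal (|g z| ^ p)) (ν l) :=
  (hg.1.1.aemeasurable.abs.pow_const p).ennreal_ofReal

/-- With the weight moved inside as `f ^ (1 / p)`, the integral becomes the `p`-th power of a
weighted `L^p` norm of the gradient, to which Minkowski's inequality applies. -/
theorem lintegral_energyMeasure {p : ℝ} (hp : 1 < p) {u : C(K l, ℝ)} {g : K l → ℝ}
    (hg : IsGradient l p u g) {f : K l → ℝ≥0∞} (hf : Measurable f) :
    ∫⁻ z, f z ∂(energyMeasure l p u) = ∫⁻ z, (‖g z‖ₑ * f z ^ (1 / p)) ^ p ∂(ν l) := by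
  have hp0 : 0 < p := by linarith
  rw [hg.energyMeasure_eq hl hp,
    lintegral_withDensity_eq_lintegral_mul₀ hg.aemeasurable_density hf.aemeasurable]
  refine lintegral_congr fun z => ?_
  rw [ENNReal.mul_rpow_of_nonneg _ _ hp0.le, ← ENNReal.rpow_mul, one_div_mul_cancel hp0.ne',
    ENNReal.rpow_one, Real.enorm_eq_ofReal_abs, ENNReal.ofReal_rpow_of_nonneg (abs_nonneg _) hp0.le]
  rfl

theorem lintegral_energyMeasure_add_le {p : ℝ} (hp : 1 < p) {u₁ u₂ : C(K l, ℝ)}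
    (hu₁ : u₁ ∈ domain l p) (hu₂ : u₂ ∈ domain l p) {f : K l → ℝ≥0∞} (hf : Measurable f) :
    (∫⁻ x, f x ∂(energyMeasure l p (u₁ + u₂))) ^ (1 / p) ≤
      (∫⁻ x, f x ∂(energyMeasure l p u₁)) ^ (1 / p) +
        (∫⁻ x, f x ∂(energyMeasure l p u₂)) ^ (1 / p) := by
  have h₁ := isGradient_gradient hl hp hu₁
  have h₂ := isGradient_gradient hl hp hu₂
  rw [lintegral_energyMeasure hl hp (h₁.add hl hp h₂) hf, lintegral_energyMeasure hl hp h₁ hf,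
    lintegral_energyMeasure hl hp h₂ hf]
  have hfp : AEMeasurable (fun z => f z ^ (1 / p)) (ν l) := (hf.pow_const _).aemeasurable
  refine le_trans ?_ (ENNReal.lintegral_Lp_add_le (h₁.1.1.aemeasurable.enorm.mul hfp)
    (h₂.1.1.aemeasurable.enorm.mul hfp) hp.le)
  gcongr with z
  simp only [Pi.add_apply]
  rw [← add_mul]
  gcongr
  exact enorm_add_le _ _

theorem energyMeasure_comp {p : ℝ} (hp : 1 < p) {f : ℝ → ℝ} (hf : ContDiff ℝ 1 f) {u : C(K l, ℝ)}
    (hu : u ∈ domain l p) :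
    energyMeasure l p ((⟨f, hf.continuous⟩ : C(ℝ, ℝ)).comp u) =
      (energyMeasure l p u).withDensity (fun x => ENNReal.ofReal (|deriv f (u x)| ^ p)) := by
  have hg := isGradient_gradient hl hp hu
  have hcont : Continuous fun z => deriv f (u z) :=
    (hf.continuous_deriv le_rfl).comp u.continuous
  rw [(hg.comp hl hp hf).energyMeasure_eq hl hp, energyMeasure, ← withDensity_mul₀
    hg.aemeasurable_density (hcont.measurable.abs.pow_const p).ennreal_ofReal.aemeasurable]
  congr 1
  ext z
  rw [Pi.mul_apply, ← ENNReal.ofReal_mul (by positivity), abs_mul,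
    Real.mul_rpow (abs_nonneg _) (abs_nonneg _), mul_comm]

theorem map_energyMeasure_absolutelyContinuous {p : ℝ} (hp : 1 < p) {u : C(K l, ℝ)}
    (hu : u ∈ domain l p) : (energyMeasure l p u).map u ≪ (volume : Measure ℝ) := by
  have hg := isGradient_gradient hl hp hu
  have hfin : IsFiniteMeasure (energyMeasure l p u) :=
    ⟨by rw [energyMeasure_univ hl hp hu]; exact hu⟩
  refine Measure.AbsolutelyContinuous.mk fun s hs hs0 => ?_
  -- The image measure is finite on the line, so by inner regularity compact subsets of the null set
  -- suffice.
  rw [hs.measure_eq_iSup_isCompact_of_ne_top (measure_ne_top _ _)]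
  simp only [ENNReal.iSup_eq_zero]
  intro A hAs hA
  have hpre := (u.continuous.measurable) hA.measurableSet
  rw [Measure.map_apply u.continuous.measurable hA.measurableSet, energyMeasure,
    withDensity_apply _ hpre, setLIntegral_eq_zero_iff' hpre hg.aemeasurable_density.restrict]
  filter_upwards [hg.ae_eq_zero_of_isCompact hl hp hA (measure_mono_null hAs hs0)] with z hz hmem
  simp [hz hmem, Real.zero_rpow (by linarith : p ≠ 0)]

end

end Vicsek

theorem theorem1p2 (l : ℕ → ℕ) (hl : ∀ k, Odd (l k) ∧ 3 ≤ l k) (p : ℝ) (hp : 1 < p) :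
    ∃ Γ : C(Vicsek.K l, ℝ) → Measure (Vicsek.K l),
      -- finite Borel measures, with density `|∂u|^p` with respect to `ν`
      (∀ u ∈ Vicsek.domain l p, IsFiniteMeasure (Γ u) ∧
        (∃ g, Vicsek.IsGradient l p u g) ∧
        (∀ g g', Vicsek.IsGradient l p u g → Vicsek.IsGradient l p u g' →
          g =ᵐ[Vicsek.ν l] g') ∧
        (∀ g, Vicsek.IsGradient l p u g →
          Γ u = (Vicsek.ν l).withDensity (fun x => ENNReal.ofReal (|g x| ^ p)))) ∧
      -- total mass, and vanishing exactly for constant functions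
      (∀ u ∈ Vicsek.domain l p,
        Γ u Set.univ = Vicsek.energy l p u ∧ (Γ u = 0 ↔ ∃ c : ℝ, ∀ x, u x = c)) ∧
      -- weighted triangle inequality
      (∀ u₁ ∈ Vicsek.domain l p, ∀ u₂ ∈ Vicsek.domain l p,
        u₁ + u₂ ∈ Vicsek.domain l p ∧
        ∀ g : Vicsek.K l → ℝ≥0∞, Measurable g →
          (∫⁻ x, g x ∂(Γ (u₁ + u₂))) ^ (1 / p) ≤
            (∫⁻ x, g x ∂(Γ u₁)) ^ (1 / p) + (∫⁻ x, g x ∂(Γ u₂)) ^ (1 / p)) ∧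
      -- chain rule
      (∀ (f : ℝ → ℝ) (hf : ContDiff ℝ 1 f), ∀ u ∈ Vicsek.domain l p,
        (⟨f, hf.continuous⟩ : C(ℝ, ℝ)).comp u ∈ Vicsek.domain l p ∧
        Γ ((⟨f, hf.continuous⟩ : C(ℝ, ℝ)).comp u) =
          (Γ u).withDensity (fun x => ENNReal.ofReal (|deriv f (u x)| ^ p))) ∧
      -- energy image density property
      (∀ u ∈ Vicsek.domain l p, (Γ u).map u ≪ (volume : Measure ℝ)) := by
  refine ⟨Vicsek.energyMeasure l p, fun u hu => ⟨?_, ?_, fun g g' hg hg' => hg.ae_eq hl hp hg',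
    fun g hg => hg.energyMeasure_eq hl hp⟩, fun u hu => ⟨Vicsek.energyMeasure_univ hl hp hu, ?_⟩,
    fun u₁ hu₁ u₂ hu₂ => ⟨?_, fun g hg => Vicsek.lintegral_energyMeasure_add_le hl hp hu₁ hu₂ hg⟩,
    fun f hf u hu => ⟨Vicsek.comp_mem_domain hl hp hf hu, Vicsek.energyMeasure_comp hl hp hf hu⟩,
    fun u hu => Vicsek.map_energyMeasure_absolutelyContinuous hl hp hu⟩
  · exact ⟨by rw [Vicsek.energyMeasure_univ hl hp hu]; exact hu⟩
  · exact ⟨_, Vicsek.isGradient_gradient hl hp hu⟩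
  · rw [← Measure.measure_univ_eq_zero, Vicsek.energyMeasure_univ hl hp hu]
    exact ⟨Vicsek.eq_const_of_energy_eq_zero hl,
      fun ⟨c, hc⟩ => Vicsek.energy_eq_zero_of_const hl hp hc⟩
  · exact ((Vicsek.isGradient_gradient hl hp hu₁).add hl hp
      (Vicsek.isGradient_gradient hl hp hu₂)).mem_domain hl hp
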